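/- Let $\mathcal X,\mathcal Y$ be complex Euclidean spaces (finite-dimensional spaces $\mathbb C^n$ with their computational bases) with $2\le\dim\mathcal X\le\dim\mathcal Y$, and let $\mathcal M(\cdot)$ denote the linear operators on a space. A quantum state is a positive semidefinite operator of trace one. A subchannel is a linear map $\Phi$ from $\mathcal M(\mathcal X)$ to $\mathcal M(\mathcal Y)$ (and similarly for other pairs of spaces) that is completely positive, i.e. $\Phi\otimes\mathrm{id}_{\mathcal M(\mathcal X)}$ preserves positive semidefiniteness, and trace non-increasing, i.e. $\operatorname{tr}\Phi(\rho)\le 1$ for every state $\rho$; it is a channel if $\operatorname{tr}\Phi(\rho)=1$ for every state $\rho$. The Choi rank of $\Phi$ is the rank of $J(\Phi)=(\Phi\otimes\mathrm{id})(|v\rangle\langle v|)$, where $|v\rangle=\sum_i|i\rangle\otimes|i\rangle\in\mathcal X\otimes\mathcal X$. A channel $\mathcal E$ on $\mathcal M(\mathcal Y)$ is perfectly correctable for $\mathcal X$ if there are subchannels $\mathcal S:\mathcal M(\mathcal X)\to\mathcal M(\mathcal Y)$ and $\mathcal R:\mathcal M(\mathcal Y)\to\mathcal M(\mathcal X)$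 with $\mathcal R\mathcal E\mathcal S=\mathrm{id}$, and probabilistically correctable for $\mathcal X$ if there are such $\mathcal S,\mathcal R$ with $0\ne\mathcal R\mathcal E\mathcal S= p\,\mathrm{id}$ for some scalar $p$. Let $r_1(\mathcal X,\mathcal Y)$ (respectively $r(\mathcal X,\mathcal Y)$) be the largest $r\in\mathbb N$ such that every channel on $\mathcal M(\mathcal Y)$ of Choi rank at most $r$ is perfectly (respectively probabilistically) correctable for $\mathcal X$. Then both maxima exist and $$\left\lfloor\sqrt[4]{\frac{\dim\mathcal Y}{\dim\mathcal X}}\right\rfloor\le r_1(\mathcal X,\mathcal Y)\le\left\lceil\sqrt{\frac{\dim\mathcal Y}{\dim\mathcal X-1}}\right\rceil-1\le r(\mathcal X,\mathcal Y)<\frac{\dim\mathcal Y\,\dim\mathcal X}{(\dim\mathcal X)^2-1}.$$ -/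

import Mathlib

open scoped ComplexOrder

/-! Finite types `X`, `Y` index the computational bases of the complex Euclidean spaces
`ℂ^X`, `ℂ^Y`; operators between them are complex matrices, `M(ℂ^X) = Matrix X X ℂ`, and the
dimension of `ℂ^X` is `Fintype.card X`. -/

namespace PQEC

section

variable {X Y : Type*} [Fintype X] [DecidableEq X] [Fintype Y] [DecidableEq Y]

/-- Quantum states: positive semidefinite operators of unit trace. -/
def IsState (ρ : Matrix X X ℂ) : Prop :=
  ρ.PosSemidef ∧ ρ.trace = 1

/-- The linear map `Φ ⊗ id`, the identity acting on the operators of the ancilla space `ℂ^Z`.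
It sends `A ⊗ B` to `Φ A ⊗ B`. -/
def tensorId (Z : Type*) (Φ : Matrix X X ℂ →ₗ[ℂ] Matrix Y Y ℂ) :
    Matrix (X × Z) (X × Z) ℂ →ₗ[ℂ] Matrix (Y × Z) (Y × Z) ℂ where
  toFun Q := Matrix.of fun p q => Φ (Matrix.of fun x x' => Q (x, p.2) (x', q.2)) p.1 q.1
  map_add' Q Q' := by
    ext p q
    have h : (Matrix.of fun x x' => (Q + Q') (x, p.2) (x', q.2)) =
        (Matrix.of fun x x' => Q (x, p.2) (x', q.2)) +
          Matrix.of fun x x' => Q' (x, p.2) (x', q.2) := by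
      ext; simp
    simp only [Matrix.of_apply, Matrix.add_apply] at h ⊢
    rw [h, map_add, Matrix.add_apply]
  map_smul' c Q := by
    ext p q
    have h : (Matrix.of fun x x' => (c • Q) (x, p.2) (x', q.2)) =
        c • Matrix.of fun x x' => Q (x, p.2) (x', q.2) := by
      ext; simp
    simp only [Matrix.of_apply, Matrix.smul_apply, RingHom.id_apply] at h ⊢
    rw [h, map_smul, Matrix.smul_apply]

/-- Complete positivity of `Φ : M(ℂ^X) → M(ℂ^Y)`: the map `Φ ⊗ id`, with the identity on
`M(ℂ^X)`, preserves positive semidefiniteness. -/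
def IsCompletelyPositive (Φ : Matrix X X ℂ →ₗ[ℂ] Matrix Y Y ℂ) : Prop :=
  ∀ Q : Matrix (X × X) (X × X) ℂ, Q.PosSemidef → (tensorId X Φ Q).PosSemidef

/-- Quantum subchannels: completely positive, trace non-increasing maps (the trace of the
image of a state is automatically real). -/
def IsSubchannel (Φ : Matrix X X ℂ →ₗ[ℂ] Matrix Y Y ℂ) : Prop :=
  IsCompletelyPositive Φ ∧ ∀ ρ : Matrix X X ℂ, IsState ρ → (Φ ρ).trace.re ≤ 1

/-- Quantum channels: subchannels that preserve the trace of states. -/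
def IsChannel (Φ : Matrix X X ℂ →ₗ[ℂ] Matrix Y Y ℂ) : Prop :=
  IsSubchannel Φ ∧ ∀ ρ : Matrix X X ℂ, IsState ρ → (Φ ρ).trace = 1

/-- Vectorization `|M⟩ = ∑ i, |i⟩ ⊗ Mᵀ|i⟩`. -/
def vectorize (M : Matrix Y X ℂ) : Y × X → ℂ := fun p => M p.1 p.2

/-- The Choi operator `J(Φ) = (Φ ⊗ id)(|1⟩⟨1|)`, where `|1⟩` is the vectorized identity. -/
def choi (Φ : Matrix X X ℂ →ₗ[ℂ] Matrix Y Y ℂ) : Matrix (Y × X) (Y × X) ℂ :=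
  tensorId X Φ (Matrix.vecMulVec (vectorize (1 : Matrix X X ℂ))
    (star (vectorize (1 : Matrix X X ℂ))))

/-- The Choi rank. -/
noncomputable def choiRank (Φ : Matrix X X ℂ →ₗ[ℂ] Matrix Y Y ℂ) : ℕ :=
  (choi Φ).rank

end

section

variable (X Y : Type*) [Fintype X] [DecidableEq X] [Fintype Y] [DecidableEq Y]

/-- `ξ(X, Y)`: the noise channels on `ℂ^Y` that are probabilistically correctable for `ℂ^X`,
i.e. `0 ≠ R ∘ E ∘ S ∝ id` for some encoding subchannel `S` and decoding subchannel `R`. -/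
def probCorrectable : Set (Matrix Y Y ℂ →ₗ[ℂ] Matrix Y Y ℂ) :=
  {E | IsChannel E ∧
    ∃ (S : Matrix X X ℂ →ₗ[ℂ] Matrix Y Y ℂ) (R : Matrix Y Y ℂ →ₗ[ℂ] Matrix X X ℂ),
      IsSubchannel S ∧ IsSubchannel R ∧ R ∘ₗ E ∘ₗ S ≠ 0 ∧
        ∃ p : ℂ, R ∘ₗ E ∘ₗ S = p • LinearMap.id}

/-- `ξ₁(X, Y)`: the noise channels on `ℂ^Y` that are perfectly correctable for `ℂ^X`. -/
def perfCorrectable : Set (Matrix Y Y ℂ →ₗ[ℂ] Matrix Y Y ℂ) :=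
  {E | IsChannel E ∧
    ∃ (S : Matrix X X ℂ →ₗ[ℂ] Matrix Y Y ℂ) (R : Matrix Y Y ℂ →ₗ[ℂ] Matrix X X ℂ),
      IsSubchannel S ∧ IsSubchannel R ∧ R ∘ₗ E ∘ₗ S = LinearMap.id}

/-- The numbers `r` such that all channels on `ℂ^Y` of Choi rank at most `r` are
probabilistically correctable for `ℂ^X`. -/
def probRanks : Set ℕ :=
  {r | ∀ E : Matrix Y Y ℂ →ₗ[ℂ] Matrix Y Y ℂ,
    IsChannel E → choiRank E ≤ r → E ∈ probCorrectable X Y}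

/-- The numbers `r` such that all channels on `ℂ^Y` of Choi rank at most `r` are
perfectly correctable for `ℂ^X`. -/
def perfRanks : Set ℕ :=
  {r | ∀ E : Matrix Y Y ℂ →ₗ[ℂ] Matrix Y Y ℂ,
    IsChannel E → choiRank E ≤ r → E ∈ perfCorrectable X Y}

/-- `r(X, Y)`, the maximum of `probRanks X Y` (whenever there is one). -/
noncomputable def rProb : ℕ := sSup (probRanks X Y)

/-- `r₁(X, Y)`, the maximum of `perfRanks X Y` (whenever there is one). -/
noncomputable def rPerf : ℕ := sSup (perfRanks X Y)

end

end PQEC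

/-!
The proof reduces channels to their Kraus operators `K i` (Choi's theorem) and studies the maps
`R * K i * S`. If a sum of maps `A ↦ L * A * Lᴴ` is a multiple of the identity, then every `L` is a
multiple of `1`, so correctability becomes a question about compressions of the `K i` to scalars.
Write `d = dim X`, `n = dim Y`.

* *Perfect correction is possible if `r⁴ d ≤ n`* (`mem_perfRanks`). One finds greedily
  `(d - 1) r² + 1` unit vectors whose images under all errors are mutually orthogonal, so that each
  product `(K i)ᴴ * K j` is diagonal on them. By Tverberg's theorem in the `r²`-dimensional real
  space of Hermitian matrices (`exists_partition_weighted_sum_eq`) they split into `d` groups with a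
  common weighted mean; the corresponding superpositions span a code satisfying the Knill–Laflamme
  conditions, from which the recovery is built.
* *Perfect correction can fail if `n ≤ r² (d - 1)`* (`notMem_perfRanks`). For a diagonal channel with
  products `(K i)ᴴ * K j` spanning `r²` orthogonal projections of rank less than `d` with sum `1`, the
  Knill–Laflamme conditions force these projections to vanish on the code.
* *Probabilistic correction is possible if `r² (d - 1) < n`* (`mem_probRanks`). Let `s` be a
  `d`-tuple of vectors for which the images `K i (s b)` span as much as possible. If these `r d`
  images are independent, a decoding exists. Otherwise a relation `∑ b, E_b (s b) = 0`, perturbed in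
  `s`, shows that the ranges of the `E_b` lie in the span of the images; so some nonzero error
  operator has rank less than `r d`, and one passes to its kernel, where fewer errors act.
* *Probabilistic correction can fail if `n d ≤ r (d² - 1)`* (`notMem_probRanks`). If an isometry
  into `ℂ^r ⊗ ℂ^X`, followed by the partial trace over `ℂ^r`, is correctable, its range contains some
  `c ⊗ ℂ^X` with `c ≠ 0`; the `r d - n` equations that define the range can exclude all `c`.
-/

namespace PQEC
open Matrix

set_option linter.unusedSectionVars false

/-! ### Kraus representations -/

section Kraus

variable {X Y Z ι κ : Type*} [Fintype X] [DecidableEq X] [Fintype Y] [DecidableEq Y]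
  [Fintype Z] [DecidableEq Z] [Fintype ι] [Fintype κ]

/-- The map `A ↦ ∑ i, K i * A * (K i)ᴴ` with Kraus operators `K i`. -/
def krausMap (K : ι → Matrix Y X ℂ) : Matrix X X ℂ →ₗ[ℂ] Matrix Y Y ℂ where
  toFun A := ∑ i, K i * A * (K i)ᴴ
  map_add' A B := by simp [Matrix.mul_add, Matrix.add_mul, Finset.sum_add_distrib]
  map_smul' c A := by simp [Finset.smul_sum]

lemma krausMap_apply (K : ι → Matrix Y X ℂ) (A : Matrix X X ℂ) :
    krausMap K A = ∑ i, K i * A * (K i)ᴴ := rfl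

open scoped Kronecker in
lemma tensorId_krausMap (K : ι → Matrix Y X ℂ) (Q : Matrix (X × Z) (X × Z) ℂ) :
    tensorId Z (krausMap K) Q =
      ∑ i, (K i ⊗ₖ (1 : Matrix Z Z ℂ)) * Q * (K i ⊗ₖ (1 : Matrix Z Z ℂ))ᴴ := by
  ext ⟨y, z⟩ ⟨y', z'⟩
  simp only [tensorId, LinearMap.coe_mk, AddHom.coe_mk, krausMap_apply, Matrix.of_apply,
    Matrix.sum_apply]
  refine Finset.sum_congr rfl fun i _ => ?_
  simp [Matrix.mul_apply, Fintype.sum_prod_type, Matrix.one_apply, apply_ite, ite_mul]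

lemma posSemidef_sum {s : Finset ι} {A : ι → Matrix X X ℂ} (h : ∀ i, (A i).PosSemidef) :
    (∑ i ∈ s, A i).PosSemidef := by
  classical
  induction s using Finset.induction_on with
  | empty => simpa using PosSemidef.zero
  | insert a s ha ih => rw [Finset.sum_insert ha]; exact (h a).add ih

lemma isCompletelyPositive_krausMap (K : ι → Matrix Y X ℂ) :
    IsCompletelyPositive (krausMap K) := by
  intro Q hQ
  rw [tensorId_krausMap]
  exact posSemidef_sum fun i => hQ.mul_mul_conjTranspose_same _

lemma choi_apply (Φ : Matrix X X ℂ →ₗ[ℂ] Matrix Y Y ℂ) (p q : Y × X) :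
    choi Φ p q = Φ (Matrix.single p.2 q.2 1) p.1 q.1 := by
  simp only [choi, tensorId, LinearMap.coe_mk, AddHom.coe_mk, Matrix.of_apply]
  refine congrArg (fun B => Φ B p.1 q.1) ?_
  ext x x'
  simp only [vecMulVec_apply, vectorize, Pi.star_apply, Matrix.of_apply, Matrix.one_apply,
    Matrix.single_apply]
  by_cases h : x = p.2 <;> by_cases h' : x' = q.2 <;> simp [h, h', eq_comm]

lemma mul_single_mul_apply (A : Matrix Y X ℂ) (B : Matrix X Y ℂ) (a b : X) (y y' : Y) :
    (A * (Matrix.single a b 1 : Matrix X X ℂ) * B) y y' = A y a * B b y' := by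
  simp [Matrix.mul_apply, Matrix.single_apply, ite_and, Finset.sum_ite_eq]

lemma choi_krausMap (K : ι → Matrix Y X ℂ) :
    choi (krausMap K) =
      (Matrix.of fun p i => vectorize (K i) p) * (Matrix.of fun p i => vectorize (K i) p)ᴴ := by
  ext p q
  rw [choi_apply, krausMap_apply, Matrix.sum_apply, Matrix.mul_apply]
  refine Finset.sum_congr rfl fun i _ => ?_
  rw [mul_single_mul_apply]
  simp [vectorize]

lemma choiRank_krausMap_le (K : ι → Matrix Y X ℂ) : choiRank (krausMap K) ≤ Fintype.card ι := by
  rw [choiRank, choi_krausMap]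
  exact (Matrix.rank_mul_le_left _ _).trans (Matrix.rank_le_card_width _)

/-- A positive semidefinite matrix is a sum of as many rank-one matrices as its rank. -/
lemma exists_mul_conjTranspose_of_posSemidef {A : Matrix X X ℂ} (hA : A.PosSemidef) :
    ∃ (m : ℕ) (B : Matrix X (Fin m) ℂ), m = A.rank ∧ A = B * Bᴴ := by
  have hr := hA.1.rank_eq_card_non_zero_eigs
  let e : Fin A.rank ≃ {i // hA.1.eigenvalues i ≠ 0} := Fintype.equivOfCardEq (by simp [hr])
  let U : Matrix X X ℂ := hA.1.eigenvectorUnitary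
  let g : X → X → X → ℂ := fun x x' j => U x j * hA.1.eigenvalues j * star (U x' j)
  refine ⟨_, Matrix.of fun x i => U x (e i) * ((√(hA.1.eigenvalues (e i)) : ℝ) : ℂ), rfl, ?_⟩
  ext x x'
  have hl : A x x' = ∑ j, g x x' j := by
    conv_lhs => rw [hA.1.spectral_theorem, Unitary.conjStarAlgAut_apply]
    rw [Matrix.mul_apply]
    refine Finset.sum_congr rfl fun j _ => ?_
    rw [Matrix.mul_diagonal]
    rfl
  have hs := Finset.sum_subtype (F := inferInstance)
    (Finset.univ.filter fun i => hA.1.eigenvalues i ≠ 0)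
    (p := fun i => hA.1.eigenvalues i ≠ 0) (by simp) (g x x')
  have hf : ∑ j with hA.1.eigenvalues j ≠ 0, g x x' j = ∑ j, g x x' j :=
    Finset.sum_filter_of_ne fun j _ hj (h0 : hA.1.eigenvalues j = 0) => hj (by simp [g, h0])
  rw [hf] at hs
  rw [hl, hs, ← e.sum_comp, Matrix.mul_apply]
  refine Finset.sum_congr rfl fun i _ => ?_
  have key : ((√(hA.1.eigenvalues (e i)) : ℝ) : ℂ) * ((√(hA.1.eigenvalues (e i)) : ℝ) : ℂ) =
      (hA.1.eigenvalues (e i) : ℂ) := by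
    rw [← Complex.ofReal_mul, Real.mul_self_sqrt (hA.eigenvalues_nonneg _)]
  simp only [g, Matrix.of_apply, Matrix.conjTranspose_apply, star_mul', RCLike.star_def,
    Complex.conj_ofReal]
  rw [← key]
  ring

/-- Choi's theorem: a completely positive map has a Kraus representation with as many operators
as its Choi rank. -/
lemma exists_krausMap {Φ : Matrix X X ℂ →ₗ[ℂ] Matrix Y Y ℂ} (hΦ : IsCompletelyPositive Φ) :
    ∃ (m : ℕ) (K : Fin m → Matrix Y X ℂ), m = choiRank Φ ∧ Φ = krausMap K := by
  have hJ : (choi Φ).PosSemidef := hΦ _ (posSemidef_vecMulVec_self_star _)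
  obtain ⟨m, B, hm, hB⟩ := exists_mul_conjTranspose_of_posSemidef hJ
  refine ⟨m, fun i => Matrix.of fun y x => B (y, x) i, hm, ?_⟩
  refine Matrix.ext_linearMap ℂ fun a b => LinearMap.ext_ring ?_
  ext y y'
  have h := choi_apply Φ (y, a) (y', b)
  rw [hB, Matrix.mul_apply] at h
  simp only [LinearMap.comp_apply, Matrix.singleLinearMap_apply]
  rw [← h, krausMap_apply, Matrix.sum_apply]
  refine Finset.sum_congr rfl fun i _ => ?_
  rw [mul_single_mul_apply]
  simp

lemma trace_krausMap (K : ι → Matrix Y X ℂ) (A : Matrix X X ℂ) :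
    (krausMap K A).trace = ((∑ i, (K i)ᴴ * K i) * A).trace := by
  rw [krausMap_apply, Matrix.trace_sum, Finset.sum_mul, Matrix.trace_sum]
  refine Finset.sum_congr rfl fun i _ => ?_
  rw [Matrix.trace_mul_comm, Matrix.mul_assoc]

lemma trace_mul_nonneg {A B : Matrix X X ℂ} (hA : A.PosSemidef) (hB : B.PosSemidef) :
    0 ≤ (A * B).trace := by
  obtain ⟨m, C, -, hC⟩ := exists_mul_conjTranspose_of_posSemidef hB
  rw [hC, ← Matrix.mul_assoc, Matrix.trace_mul_comm, ← Matrix.mul_assoc]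
  exact (hA.conjTranspose_mul_mul_same C).trace_nonneg

lemma isSubchannel_krausMap {K : ι → Matrix Y X ℂ}
    (hK : (1 - ∑ i, (K i)ᴴ * K i).PosSemidef) : IsSubchannel (krausMap K) := by
  refine ⟨isCompletelyPositive_krausMap K, fun ρ hρ => ?_⟩
  have h := trace_mul_nonneg hK hρ.1
  rw [Matrix.sub_mul, Matrix.one_mul, Matrix.trace_sub, hρ.2, ← trace_krausMap] at h
  have := (Complex.le_def.1 h).1
  simp at this
  exact this

lemma isChannel_krausMap {K : ι → Matrix Y X ℂ} (hK : ∑ i, (K i)ᴴ * K i = 1) :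
    IsChannel (krausMap K) := by
  refine ⟨isSubchannel_krausMap (by rw [hK, sub_self]; exact PosSemidef.zero), fun ρ hρ => ?_⟩
  rw [trace_krausMap, hK, Matrix.one_mul, hρ.2]

lemma trace_mul_vecMulVec_star (A : Matrix X X ℂ) (x : X → ℂ) :
    (A * vecMulVec x (star x)).trace = star x ⬝ᵥ (A *ᵥ x) := by
  rw [Matrix.mul_vecMulVec, Matrix.trace_vecMulVec, dotProduct_comm]

lemma isHermitian_sum_gram (K : ι → Matrix Y X ℂ) : (∑ i, (K i)ᴴ * K i).IsHermitian :=
  (posSemidef_sum fun i => posSemidef_conjTranspose_mul_self (K i)).1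

/-- Conversely, trace non-increase on pure states bounds the quadratic form of
`∑ i, (K i)ᴴ * K i`. -/
lemma posSemidef_of_isSubchannel {K : ι → Matrix Y X ℂ} (h : IsSubchannel (krausMap K)) :
    (1 - ∑ i, (K i)ᴴ * K i).PosSemidef := by
  refine PosSemidef.of_dotProduct_mulVec_nonneg
    (isHermitian_one.sub (isHermitian_sum_gram K)) fun x => ?_
  have hG := posSemidef_sum (s := Finset.univ) fun i => posSemidef_conjTranspose_mul_self (K i)
  have hG0 := hG.dotProduct_mulVec_nonneg x
  rw [Matrix.sub_mulVec, Matrix.one_mulVec, dotProduct_sub, sub_nonneg]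
  have hx0 : 0 ≤ star x ⬝ᵥ x := dotProduct_star_self_nonneg x
  by_cases hx : star x ⬝ᵥ x = 0
  · rw [dotProduct_star_self_eq_zero] at hx
    simp [hx]
  set t : ℂ := star x ⬝ᵥ x with ht
  have hρ : IsState (t⁻¹ • vecMulVec x (star x)) := by
    refine ⟨(posSemidef_vecMulVec_self_star x).smul (inv_nonneg.2 hx0), ?_⟩
    rw [Matrix.trace_smul, Matrix.trace_vecMulVec, dotProduct_comm, ← ht, smul_eq_mul,
      inv_mul_cancel₀ hx]
  have h1 := h.2 _ hρ
  rw [trace_krausMap, Matrix.mul_smul, Matrix.trace_smul, trace_mul_vecMulVec_star] at h1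
  have h2 : t⁻¹ • (star x ⬝ᵥ (∑ i, (K i)ᴴ * K i) *ᵥ x) ≤ 1 := by
    rw [Complex.le_def]
    refine ⟨h1, ?_⟩
    have := (Complex.le_def.1 (mul_nonneg (inv_nonneg.2 hx0) hG0)).2
    simpa using this.symm
  calc star x ⬝ᵥ (∑ i, (K i)ᴴ * K i) *ᵥ x
      = t * (t⁻¹ • (star x ⬝ᵥ (∑ i, (K i)ᴴ * K i) *ᵥ x)) := by
        rw [smul_eq_mul, mul_inv_cancel_left₀ hx]
    _ ≤ t * 1 := mul_le_mul_of_nonneg_left h2 hx0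
    _ = t := mul_one t

lemma sum_gram_eq_one_of_isChannel {K : ι → Matrix Y X ℂ} (h : IsChannel (krausMap K)) :
    ∑ i, (K i)ᴴ * K i = 1 := by
  have hP := posSemidef_of_isSubchannel h.1
  have h0 : (1 - ∑ i, (K i)ᴴ * K i).trace = 0 := by
    rw [Matrix.trace_sub, sub_eq_zero, Matrix.trace_one]
    have hc : ∀ x : X, ((∑ i, (K i)ᴴ * K i) * vecMulVec (Pi.single x 1) (star (Pi.single x 1))).trace
        = 1 := fun x => by
      rw [← trace_krausMap]
      refine h.2 _ ⟨posSemidef_vecMulVec_self_star _, ?_⟩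
      simp [Matrix.trace_vecMulVec]
    simp only [trace_mul_vecMulVec_star] at hc
    have : (∑ i, (K i)ᴴ * K i).trace = ∑ _x : X, (1 : ℂ) := by
      refine Finset.sum_congr rfl fun x _ => ?_
      have := hc x
      simpa using this
    rw [this]; simp
  rw [hP.trace_eq_zero_iff, sub_eq_zero] at h0
  exact h0.symm

/-- If a map with Kraus operators `A j` is a multiple of the identity, then so is
each `A j`. -/
lemma eq_smul_one_of_krausMap_eq_smul [Nonempty X] {A : ι → Matrix X X ℂ} {p : ℂ}
    (h : krausMap A = p • LinearMap.id) (j : ι) : ∃ c : ℂ, A j = c • 1 := by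
  have key : ∀ x y : X → ℂ, star y ⬝ᵥ x = 0 → star y ⬝ᵥ (A j *ᵥ x) = 0 := by
    intro x y hxy
    have h1 := congrArg (fun Φ => star y ⬝ᵥ (Φ (vecMulVec x (star x)) *ᵥ y)) h
    simp only [krausMap_apply, LinearMap.smul_apply, LinearMap.id_apply] at h1
    rw [Matrix.smul_mulVec, vecMulVec_mulVec, dotProduct_smul] at h1
    have h2 : star y ⬝ᵥ MulOpposite.op (star x ⬝ᵥ y) • x = 0 := by
      rw [dotProduct_smul, hxy, smul_zero]
    rw [h2, smul_zero, Matrix.sum_mulVec, dotProduct_sum] at h1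
    have h3 : ∀ i, star y ⬝ᵥ ((A i * vecMulVec x (star x) * (A i)ᴴ) *ᵥ y) =
        (star y ⬝ᵥ (A i *ᵥ x)) * star (star y ⬝ᵥ (A i *ᵥ x)) := by
      intro i
      rw [Matrix.mul_vecMulVec, Matrix.vecMulVec_mul, vecMulVec_mulVec, dotProduct_smul,
        ← Matrix.star_mulVec, ← star_dotProduct_star, star_star]
      simp [dotProduct_comm]
    simp only [h3] at h1
    rw [Finset.sum_eq_zero_iff_of_nonneg (fun i _ => mul_star_self_nonneg _)] at h1
    simpa using h1 j (Finset.mem_univ j)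
  have hoff : ∀ a b : X, a ≠ b → A j b a = 0 := fun a b hab => by
    have := key (Pi.single a 1) (Pi.single b 1) (by simp [hab])
    simpa using this
  obtain ⟨o⟩ := ‹Nonempty X›
  refine ⟨A j o o, ?_⟩
  ext a b
  by_cases hab : a = b
  · subst hab
    by_cases hao : a = o
    · simp [hao]
    have := key (Pi.single a 1 + Pi.single o 1) (Pi.single a 1 - Pi.single o 1)
      (by simp [dotProduct_add, hao, Ne.symm hao])
    simp [sub_dotProduct, dotProduct_add, Matrix.mulVec_add, hoff a o hao,
      hoff o a (Ne.symm hao)] at this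
    simpa using eq_of_sub_eq_zero ((sub_eq_add_neg _ _).trans this)
  · simp [hab, hoff b a (Ne.symm hab)]

lemma krausMap_comp {W : Type*} [Fintype W] [DecidableEq W] (K : ι → Matrix Y X ℂ)
    (L : κ → Matrix W Y ℂ) :
    krausMap L ∘ₗ krausMap K = krausMap fun p : κ × ι => L p.1 * K p.2 := by
  refine LinearMap.ext fun A => ?_
  simp only [LinearMap.comp_apply, krausMap_apply, Fintype.sum_prod_type, Matrix.mul_sum,
    Matrix.sum_mul, Matrix.conjTranspose_mul, Matrix.mul_assoc]

end Kraus

/-! ### Tverberg's theorem -/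

section Tverberg

open scoped RealInnerProductSpace

lemma norm_sq_le_inner_of_forall_norm_le {E : Type*} [NormedAddCommGroup E] [InnerProductSpace ℝ E]
    {p q : E} (h : ∀ t : ℝ, 0 ≤ t → t ≤ 1 → ‖p‖ ≤ ‖(1 - t) • p + t • q‖) : ‖p‖ ^ 2 ≤ ⟪q, p⟫ := by
  have hd : ⟪q, p⟫ = ‖p‖ ^ 2 + ⟪p, q - p⟫ := by
    rw [inner_sub_right, real_inner_self_eq_norm_sq, real_inner_comm]; ring
  rw [hd, le_add_iff_nonneg_right]
  by_contra! hneg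
  have key : ∀ t : ℝ, 0 ≤ t → t ≤ 1 → 0 ≤ 2 * t * ⟪p, q - p⟫ + t ^ 2 * ‖q - p‖ ^ 2 := by
    intro t h0 h1
    have h2 := pow_le_pow_left₀ (norm_nonneg _) (h t h0 h1) 2
    have h3 : (1 - t) • p + t • q = p + t • (q - p) := by module
    rw [h3, norm_add_sq_real, inner_smul_right, norm_smul, mul_pow, Real.norm_eq_abs, sq_abs] at h2
    linarith
  by_cases hle : ‖q - p‖ ^ 2 ≤ -⟪p, q - p⟫
  · have := key 1 zero_le_one le_rfl
    linarith
  · push Not at hle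
    have hpos : 0 < ‖q - p‖ ^ 2 := by linarith
    have := key (-⟪p, q - p⟫ / ‖q - p‖ ^ 2) (div_nonneg (by linarith) hpos.le)
      ((div_le_one hpos).2 hle.le)
    have h4 : 2 * (-⟪p, q - p⟫ / ‖q - p‖ ^ 2) * ⟪p, q - p⟫ +
        (-⟪p, q - p⟫ / ‖q - p‖ ^ 2) ^ 2 * ‖q - p‖ ^ 2 = -(⟪p, q - p⟫ ^ 2 / ‖q - p‖ ^ 2) := by
      field_simp
      ring
    rw [h4] at this
    have : 0 < ⟪p, q - p⟫ ^ 2 / ‖q - p‖ ^ 2 := div_pos (sq_pos_of_neg hneg) hpos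
    linarith

/-- Weights of a point of the simplex can be moved along a direction of total weight zero until
one of them vanishes. -/
lemma exists_add_smul_mem_stdSimplex {ι : Type*} [Fintype ι] {w β : ι → ℝ}
    (hw : w ∈ stdSimplex ℝ ι) (hβ : β ≠ 0) (hβ0 : ∑ i, β i = 0) :
    ∃ t : ℝ, w + t • β ∈ stdSimplex ℝ ι ∧ ∃ i, (w + t • β) i = 0 := by
  have hneg : (Finset.univ.filter fun i => β i < 0).Nonempty := by
    by_contra hne
    rw [Finset.not_nonempty_iff_eq_empty, Finset.filter_eq_empty_iff] at hne
    refine hβ (funext fun i => ?_)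
    exact (Finset.sum_eq_zero_iff_of_nonneg fun i _ => not_lt.1 (hne (Finset.mem_univ i))).1 hβ0 i
      (Finset.mem_univ i)
  obtain ⟨i₀, hi₀, hmin⟩ := Finset.exists_min_image _ (fun i => w i / -β i) hneg
  rw [Finset.mem_filter_univ] at hi₀
  have ht : 0 ≤ w i₀ / -β i₀ := div_nonneg (hw.1 i₀) (by linarith)
  refine ⟨w i₀ / -β i₀, ⟨fun i => ?_, ?_⟩, i₀, ?_⟩
  · simp only [Pi.add_apply, Pi.smul_apply, smul_eq_mul]
    by_cases hi : β i < 0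
    · have h := hmin i (by simpa using hi)
      have h' := (le_div_iff₀ (by linarith : 0 < -β i)).1 h
      linarith
    · have := mul_nonneg ht (not_lt.1 hi)
      have := hw.1 i
      linarith
  · simp only [Pi.add_apply, Pi.smul_apply, Finset.sum_add_distrib, ← Finset.smul_sum, hβ0,
      smul_zero, add_zero, hw.2]
  · simp only [Pi.add_apply, Pi.smul_apply, smul_eq_mul]
    rw [div_mul_eq_mul_div, div_neg, mul_div_cancel_right₀ _ hi₀.ne, add_neg_cancel]

/-- Bárány's colourful Carathéodory theorem, for finite colour classes `x i` with sum zero: if there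
are more classes than the dimension, then `0` is a convex combination of a transversal. -/
theorem exists_transversal_sum_smul_eq_zero {E ι κ : Type*} [NormedAddCommGroup E]
    [InnerProductSpace ℝ E] [FiniteDimensional ℝ E] [Fintype ι] [DecidableEq ι] [Fintype κ]
    [Nonempty κ] (hι : Module.finrank ℝ E < Fintype.card ι) (x : ι → κ → E)
    (hx : ∀ i, ∑ l, x i l = 0) :
    ∃ (j : ι → κ) (w : ι → ℝ), w ∈ stdSimplex ℝ ι ∧ ∑ i, w i • x i (j i) = 0 := by
  have hne : Nonempty ι := Fintype.card_pos_iff.1 (by omega)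
  -- Take the point of smallest norm in the convex hulls of all transversals.
  obtain ⟨j, w, hw, hmin⟩ : ∃ (j : ι → κ) (w : ι → ℝ), w ∈ stdSimplex ℝ ι ∧
      ∀ (j' : ι → κ) (w' : ι → ℝ), w' ∈ stdSimplex ℝ ι →
        ‖∑ i, w i • x i (j i)‖ ≤ ‖∑ i, w' i • x i (j' i)‖ := by
    have h1 : ∀ j : ι → κ, ∃ w ∈ stdSimplex ℝ ι, ∀ w' ∈ stdSimplex ℝ ι,
        ‖∑ i, w i • x i (j i)‖ ≤ ‖∑ i, w' i • x i (j i)‖ := fun j => by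
      obtain ⟨w, hw, hm⟩ := (isCompact_stdSimplex ℝ ι).exists_isMinOn
        (f := fun w : ι → ℝ => ‖∑ i, w i • x i (j i)‖)
        ⟨_, single_mem_stdSimplex ℝ (Classical.arbitrary ι)⟩ (by fun_prop)
      exact ⟨w, hw, fun w' hw' => hm hw'⟩
    choose w hw hmin using h1
    obtain ⟨j, hj⟩ := Finite.exists_min fun j : ι → κ => ‖∑ i, w j i • x i (j i)‖
    exact ⟨j, w j, hw j, fun j' w' hw' => (hj j').trans (hmin j' w' hw')⟩
  refine ⟨j, w, hw, ?_⟩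
  by_contra hp
  set p := ∑ i, w i • x i (j i) with hpdef
  -- The first-order condition at the minimum, in the direction of a vertex.
  have hvar : ∀ (j' : ι → κ) (w' : ι → ℝ), w' ∈ stdSimplex ℝ ι → ∑ i, w' i • x i (j' i) = p →
      ∀ i, ‖p‖ ^ 2 ≤ ⟪x i (j' i), p⟫ := by
    intro j' w' hw' hp' i
    refine norm_sq_le_inner_of_forall_norm_le fun t h0 h1 => ?_
    have hmem := convex_stdSimplex ℝ ι hw' (single_mem_stdSimplex ℝ i) (sub_nonneg.2 h1) h0
      (by ring)
    refine (hmin j' _ hmem).trans_eq (congrArg norm ?_)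
    rw [← hp']
    simp [add_smul, Finset.sum_add_distrib, Finset.smul_sum, smul_smul, Pi.single_apply]
  have hp0 : 0 < ‖p‖ ^ 2 := by positivity
  obtain ⟨w', hw', hp', i₀, hi₀⟩ : ∃ w' ∈ stdSimplex ℝ ι, ∑ i, w' i • x i (j i) = p ∧
      ∃ i, w' i = 0 := by
    by_cases hpos : ∃ i, w i = 0
    · exact ⟨w, hw, rfl, hpos⟩
    push Not at hpos
    have heq : ∀ i, ⟪x i (j i), p⟫ = ‖p‖ ^ 2 := by
      have hs : ∑ i, w i * (⟪x i (j i), p⟫ - ‖p‖ ^ 2) = 0 := by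
        simp only [mul_sub, Finset.sum_sub_distrib, ← Finset.sum_mul, hw.2, ← real_inner_smul_left,
          ← sum_inner]
        rw [← hpdef, real_inner_self_eq_norm_sq]; ring
      rw [Finset.sum_eq_zero_iff_of_nonneg fun i _ =>
        mul_nonneg (hw.1 i) (sub_nonneg.2 (hvar j w hw rfl i))] at hs
      intro i
      have := (mul_eq_zero.1 (hs i (Finset.mem_univ i))).resolve_left (hpos i)
      linarith
    have hdep : ¬LinearIndependent ℝ fun i => x i (j i) := fun h => by
      have := h.fintype_card_le_finrank
      omega
    obtain ⟨β, hβ, i, hi⟩ := Fintype.not_linearIndependent_iff.1 hdep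
    have hβ0 : ∑ i, β i = 0 := by
      have h := congrArg (fun v => ⟪v, p⟫) hβ
      simp only [sum_inner, real_inner_smul_left, heq, inner_zero_left, ← Finset.sum_mul] at h
      exact (mul_eq_zero.1 h).resolve_right hp0.ne'
    obtain ⟨t, ht, ht0⟩ := exists_add_smul_mem_stdSimplex hw (fun h => hi (congrFun h i)) hβ0
    refine ⟨_, ht, ?_, ht0⟩
    simp only [Pi.add_apply, Pi.smul_apply, add_smul, Finset.sum_add_distrib, smul_eq_mul, mul_smul,
      ← Finset.smul_sum, hβ, smul_zero, add_zero, hpdef]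
  -- The class `i₀` is not used, so its representative may be chosen on the other side of `0`.
  obtain ⟨l, hl⟩ : ∃ l, ⟪x i₀ l, p⟫ ≤ 0 := by
    by_contra! h
    have := Finset.sum_pos (fun l _ => h l) (Finset.univ_nonempty (α := κ))
    rw [← sum_inner, hx, inner_zero_left] at this
    exact this.false
  have h := hvar (Function.update j i₀ l) w' hw' (by
    rw [← hp']
    refine Finset.sum_congr rfl fun i _ => ?_
    by_cases hi : i = i₀
    · subst hi; simp [hi₀]
    · rw [Function.update_of_ne hi]) i₀
  rw [Function.update_self] at h
  linarith

/-- Tverberg's theorem in homogeneous form, by Sarkaria's tensor trick: more than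
`(|κ| - 1) |β|` vectors of `ℝ^β` can be partitioned into `|κ|` parts and given nonnegative weights,
not all zero, so that all parts have the same weighted sum. -/
theorem exists_partition_weighted_sum_eq {ι κ β : Type*} [Fintype ι] [DecidableEq ι] [Fintype κ]
    [DecidableEq κ] [Nonempty κ] [Fintype β] [DecidableEq β] (a : ι → β → ℝ)
    (h : (Fintype.card κ - 1) * Fintype.card β < Fintype.card ι) :
    ∃ (j : ι → κ) (w : ι → ℝ) (m : β → ℝ), w ∈ stdSimplex ℝ ι ∧
      ∀ l b, ∑ i, (if j i = l then w i * a i b else 0) = m b := by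
  let o : κ := Classical.arbitrary κ
  -- The vectors `e l` for `l ≠ o` and `- ∑ l, e l` for `l = o` only have the obvious relation.
  let x : ι → κ → EuclideanSpace ℝ ({l : κ // l ≠ o} × β) := fun i l =>
    WithLp.toLp 2 fun q => (if l = q.1 then a i q.2 else 0) - if l = o then a i q.2 else 0
  obtain ⟨j, w, hw, h0⟩ := exists_transversal_sum_smul_eq_zero (x := x) (by
      rw [finrank_euclideanSpace, Fintype.card_prod, Fintype.card_subtype_compl,
        Fintype.card_subtype_eq]
      exact h) (fun i => by
      ext q
      simp [x, Finset.sum_sub_distrib, WithLp.ofLp_sum])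
  refine ⟨j, w, fun b => ∑ i, if j i = o then w i * a i b else 0, hw, fun l b => ?_⟩
  by_cases hl : l = o
  · rw [hl]
  have := congrArg (fun v => v.ofLp (⟨l, hl⟩, b)) h0
  simp only [x, WithLp.ofLp_sum, Finset.sum_apply, WithLp.ofLp_smul, Pi.smul_apply, smul_eq_mul,
    WithLp.ofLp_zero, Pi.zero_apply, mul_sub, mul_ite, mul_zero, Finset.sum_sub_distrib] at this
  exact sub_eq_zero.1 this

end Tverberg

/-! ### Perfectly correctable channels -/

section

variable {X Y : Type*} [Fintype X] [DecidableEq X] [Fintype Y] [DecidableEq Y]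

lemma star_dotProduct_gram_mulVec {ι : Type*} (K : ι → Matrix Y Y ℂ) (x y : Y → ℂ) (i j : ι) :
    star (star y ⬝ᵥ (((K i)ᴴ * K j) *ᵥ x)) = star x ⬝ᵥ (((K j)ᴴ * K i) *ᵥ y) := by
  rw [Matrix.star_dotProduct x, Matrix.star_mulVec, ← Matrix.dotProduct_mulVec,
    Matrix.conjTranspose_mul, Matrix.conjTranspose_conjTranspose]

/-- Unit vectors whose error images are mutually orthogonal, found greedily: each of them excludes
`s²` dimensions for the next one. -/
lemma exists_orthogonal_images {s : ℕ} (K : Fin s → Matrix Y Y ℂ) (N : ℕ)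
    (hN : ∀ M < N, M * s ^ 2 < Fintype.card Y) :
    ∃ x : ℕ → Y → ℂ, (∀ a < N, star (x a) ⬝ᵥ x a = 1) ∧
      ∀ a < N, ∀ b < N, a ≠ b → ∀ i j, star (x b) ⬝ᵥ (((K i)ᴴ * K j) *ᵥ x a) = 0 := by
  induction N with
  | zero => exact ⟨0, by simp, by simp⟩
  | succ N ih =>
    obtain ⟨x, hx1, hx⟩ := ih fun M hM => hN M (hM.trans N.lt_succ_self)
    let Λ : (Y → ℂ) →ₗ[ℂ] (Fin N × Fin s × Fin s → ℂ) := LinearMap.pi fun q =>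
      (LinearMap.mk (dotProductBilin ℂ ℂ (star (x q.1))).toAddHom (by simp)) ∘ₗ
        ((K q.2.1)ᴴ * K q.2.2).mulVecLin
    have hlt : Module.finrank ℂ (Fin N × Fin s × Fin s → ℂ) < Module.finrank ℂ (Y → ℂ) := by
      rw [Module.finrank_fintype_fun_eq_card, Module.finrank_fintype_fun_eq_card]
      simpa [sq] using hN N N.lt_succ_self
    obtain ⟨v, hv, hv0⟩ := (Submodule.ne_bot_iff _).1
      (LinearMap.ker_ne_bot_of_finrank_lt (f := Λ) hlt)
    have hv' : ∀ a < N, ∀ i j, star (x a) ⬝ᵥ (((K i)ᴴ * K j) *ᵥ v) = 0 := fun a ha i j =>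
      congrFun (LinearMap.mem_ker.1 hv) (⟨a, ha⟩, i, j)
    have hvpos : 0 < ∑ y, ‖v y‖ ^ 2 := by
      obtain ⟨y, hy⟩ := Function.ne_iff.1 hv0
      refine Finset.sum_pos' (fun _ _ => by positivity) ⟨y, Finset.mem_univ y, ?_⟩
      have : 0 < ‖v y‖ := norm_pos_iff.2 hy
      positivity
    let τ : ℂ := ((√(∑ y, ‖v y‖ ^ 2))⁻¹ : ℝ)
    have hvv : star v ⬝ᵥ v = ((∑ y, ‖v y‖ ^ 2 : ℝ) : ℂ) := by
      rw [dotProduct, Complex.ofReal_sum]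
      refine Finset.sum_congr rfl fun y _ => ?_
      rw [Pi.star_apply, RCLike.star_def, Complex.conj_mul']
      push_cast
      rfl
    have hτ : star (τ • v) ⬝ᵥ (τ • v) = 1 := by
      rw [star_smul, smul_dotProduct, dotProduct_smul, hvv, smul_eq_mul, smul_eq_mul,
        RCLike.star_def, Complex.conj_ofReal, ← Complex.ofReal_mul, ← Complex.ofReal_mul]
      norm_cast
      have h1 := Real.sqrt_pos.2 hvpos
      have h2 := Real.mul_self_sqrt hvpos.le
      nth_rewrite 3 [← h2]
      field_simp
    have hτ' : ∀ a < N, ∀ i j, star (x a) ⬝ᵥ (((K i)ᴴ * K j) *ᵥ (τ • v)) = 0 := by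
      intro a ha i j
      rw [Matrix.mulVec_smul, dotProduct_smul, hv' a ha, smul_zero]
    refine ⟨Function.update x N (τ • v), fun a ha => ?_, fun a ha b hb hab i j => ?_⟩
    · rcases Nat.lt_succ_iff_lt_or_eq.1 ha with h | rfl
      · rw [Function.update_of_ne h.ne]; exact hx1 a h
      · rw [Function.update_self]; exact hτ
    · rcases Nat.lt_succ_iff_lt_or_eq.1 ha with h | rfl <;>
        rcases Nat.lt_succ_iff_lt_or_eq.1 hb with h' | rfl
      · rw [Function.update_of_ne h.ne, Function.update_of_ne h'.ne]
        exact hx a h b h' hab i j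
      · rw [Function.update_of_ne h.ne, Function.update_self, ← star_dotProduct_gram_mulVec,
          hτ' a h, star_zero]
      · rw [Function.update_of_ne h'.ne, Function.update_self]
        exact hτ' b h' i j
      · exact absurd rfl hab

/-- Codes for Knill–Laflamme: if `s⁴ (dim X - 1) < dim Y`, some isometry `W` compresses all
products `(K i)ᴴ * K j` of `s` Kraus operators of a channel to scalars. -/
lemma exists_isometry_gram_eq_smul [Nonempty X] {s : ℕ} {K : Fin s → Matrix Y Y ℂ}
    (hK : ∑ i, (K i)ᴴ * K i = 1) (hs : (Fintype.card X - 1) * s ^ 4 < Fintype.card Y) :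
    ∃ (W : Matrix Y X ℂ) (M : Matrix (Fin s) (Fin s) ℂ), Wᴴ * W = 1 ∧
      ∀ i j, (K i * W)ᴴ * (K j * W) = M i j • 1 := by
  set d := Fintype.card X with hd
  have hd0 : 0 < d := Fintype.card_pos
  obtain ⟨x, hx1, hx⟩ := exists_orthogonal_images K ((d - 1) * s ^ 2 + 1) (fun M hM => by
    refine lt_of_le_of_lt ?_ hs
    calc M * s ^ 2 ≤ ((d - 1) * s ^ 2) * s ^ 2 := Nat.mul_le_mul_right _ (Nat.lt_succ_iff.1 hM)
      _ = (d - 1) * s ^ 4 := by ring)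
  let g : ℕ → Fin s → Fin s → ℂ := fun α i j => star (x α) ⬝ᵥ (((K i)ᴴ * K j) *ᵥ x α)
  have hg : ∀ α i j, g α j i = star (g α i j) := fun α i j =>
    (star_dotProduct_gram_mulVec K _ _ _ _).symm
  -- A Hermitian matrix is determined by the entries of the real matrix `re + im`.
  obtain ⟨c, w, m, hw, hm⟩ := exists_partition_weighted_sum_eq (κ := X)
    (fun (α : Fin ((d - 1) * s ^ 2 + 1)) (q : Fin s × Fin s) => (g α q.1 q.2).re + (g α q.1 q.2).im)
    (by simp [← hd, sq])
  let M : Matrix (Fin s) (Fin s) ℂ := Matrix.of fun i j =>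
    d * ((((m (i, j) + m (j, i)) / 2 : ℝ) : ℂ) + (((m (i, j) - m (j, i)) / 2 : ℝ) : ℂ) * Complex.I)
  have hM : ∀ l i j, ∑ α, (if c α = l then ((d * w α : ℝ) : ℂ) * g α i j else 0) = M i j := by
    intro l i j
    let t : Fin ((d - 1) * s ^ 2 + 1) → Fin s → Fin s → ℝ := fun α i j =>
      if c α = l then w α * ((g α i j).re + (g α i j).im) else 0
    have ht : ∀ i j, ∑ α, t α i j = m (i, j) := fun i j => hm l (i, j)
    have hα : ∀ α : Fin ((d - 1) * s ^ 2 + 1),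
        (if c α = l then ((d * w α : ℝ) : ℂ) * g α i j else 0) =
        d * ((((t α i j + t α j i) / 2 : ℝ) : ℂ) +
          (((t α i j - t α j i) / 2 : ℝ) : ℂ) * Complex.I) := by
      intro α
      simp only [t, hg α i j]
      split_ifs
      · apply Complex.ext <;> simp <;> ring
      · simp
    rw [Finset.sum_congr rfl fun α _ => hα α, ← Finset.mul_sum, Finset.sum_add_distrib,
      ← Finset.sum_mul, ← Complex.ofReal_sum, ← Complex.ofReal_sum, ← Finset.sum_div,
      ← Finset.sum_div, Finset.sum_add_distrib, Finset.sum_sub_distrib, ht, ht]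
    rfl
  have hgram : ∀ α, ∑ i, g α i i = star (x α) ⬝ᵥ x α := fun α => by
    simp only [g]
    rw [← dotProduct_sum, ← Matrix.sum_mulVec, hK, Matrix.one_mulVec]
  have htr : ∀ l, ∑ α : Fin ((d - 1) * s ^ 2 + 1), (if c α = l then ((d * w α : ℝ) : ℂ) else 0) =
      ∑ i, M i i := by
    intro l
    rw [← Finset.sum_congr rfl fun i _ => hM l i i, Finset.sum_comm]
    refine Finset.sum_congr rfl fun α _ => ?_
    split_ifs
    · rw [← Finset.mul_sum, hgram, hx1 α α.2, mul_one]
    · simp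
  have htr1 : ∑ i, M i i = 1 := by
    have h1 : ∑ l : X, ∑ i, M i i = d := by
      rw [← Finset.sum_congr rfl fun l _ => htr l, Finset.sum_comm]
      simp only [Finset.sum_ite_eq, Finset.mem_univ, if_true]
      rw [← Complex.ofReal_sum, ← Finset.mul_sum, hw.2]
      simp
    rw [Finset.sum_const, Finset.card_univ, ← hd, nsmul_eq_mul] at h1
    exact mul_left_cancel₀ (Nat.cast_ne_zero.2 hd0.ne') (h1.trans (mul_one _).symm)
  -- By orthogonality, superpositions with amplitudes the square roots of the weights turn weighted
  -- sums of the `g α` into matrix elements; the factor `d` normalizes each group to weight `1`.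
  let W : Matrix Y X ℂ := Matrix.of fun y l =>
    ∑ α : Fin ((d - 1) * s ^ 2 + 1), if c α = l then ((√(d * w α) : ℝ) : ℂ) * x α y else 0
  have hWM : ∀ i j, (K i * W)ᴴ * (K j * W) = M i j • 1 := by
    intro i j
    have hcol : ∀ l, (fun y => W y l) = ∑ α : Fin ((d - 1) * s ^ 2 + 1),
        (if c α = l then ((√(d * w α) : ℝ) : ℂ) else 0) • x α := fun l => by
      ext y
      simp only [W, Matrix.of_apply, Finset.sum_apply, Pi.smul_apply, smul_eq_mul, ite_mul,
        zero_mul]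
    ext l l'
    have h1 : ((K i * W)ᴴ * (K j * W)) l l' =
        star (fun y => W y l) ⬝ᵥ (((K i)ᴴ * K j) *ᵥ fun y => W y l') := by
      rw [Matrix.conjTranspose_mul, Matrix.mul_assoc, ← Matrix.mul_assoc (K i)ᴴ]
      rfl
    rw [h1, hcol, hcol, star_sum, sum_dotProduct, Matrix.smul_apply, Matrix.one_apply]
    have h2 : ∀ α : Fin ((d - 1) * s ^ 2 + 1),
        star ((if c α = l then ((√(d * w α) : ℝ) : ℂ) else 0) • x α) ⬝ᵥ (((K i)ᴴ * K j) *ᵥ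
          ∑ α : Fin ((d - 1) * s ^ 2 + 1),
            (if c α = l' then ((√(d * w α) : ℝ) : ℂ) else 0) • x α) =
        if l = l' then (if c α = l then ((d * w α : ℝ) : ℂ) * g α i j else 0) else 0 := by
      intro α
      rw [Matrix.mulVec_sum, dotProduct_sum, Finset.sum_eq_single α]
      · rw [Matrix.mulVec_smul, dotProduct_smul, star_smul, smul_dotProduct]
        have hsq : ((√(d * w α) : ℝ) : ℂ) * ((√(d * w α) : ℝ) : ℂ) = ((d * w α : ℝ) : ℂ) := by
          rw [← Complex.ofReal_mul, Real.mul_self_sqrt (mul_nonneg (Nat.cast_nonneg _) (hw.1 α))]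
        by_cases h : c α = l
        · by_cases h' : l = l'
          · have : c α = l' := h.trans h'
            simp only [h, h', if_true, smul_eq_mul, RCLike.star_def, Complex.conj_ofReal]
            rw [← mul_assoc, hsq]
          · have : c α ≠ l' := fun h'' => h' (h.symm.trans h'')
            simp [h', this]
        · simp [h]
      · intro b _ hb
        rw [Matrix.mulVec_smul, dotProduct_smul, star_smul, smul_dotProduct,
          hx b b.2 α α.2 (fun h => hb (Fin.ext h)), smul_zero, smul_zero]
      · simp
    rw [Finset.sum_congr rfl fun α _ => h2 α]
    split_ifs with h
    · rw [hM, smul_eq_mul, mul_one]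
    · simp
  refine ⟨W, M, ?_, hWM⟩
  calc Wᴴ * W = ∑ i, (K i * W)ᴴ * (K i * W) := by
        conv_lhs => rw [← Matrix.mul_one Wᴴ, ← hK, Matrix.mul_sum, Matrix.sum_mul]
        simp only [Matrix.conjTranspose_mul, Matrix.mul_assoc]
    _ = 1 := by simp only [hWM, ← Finset.sum_smul, htr1, one_smul]

/-- Sufficiency of the Knill–Laflamme conditions: after a unitary change of the Kraus operators
the error spaces are orthogonal, and the recovery maps each of them back to the code. -/
lemma mem_perfCorrectable_of_gram_eq_smul [Nonempty X] {s : ℕ} {K : Fin s → Matrix Y Y ℂ}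
    (hK : IsChannel (krausMap K)) {W : Matrix Y X ℂ} {M : Matrix (Fin s) (Fin s) ℂ}
    (hW : Wᴴ * W = 1) (hM : ∀ i j, (K i * W)ᴴ * (K j * W) = M i j • 1) :
    krausMap K ∈ perfCorrectable X Y := by
  have h1 := sum_gram_eq_one_of_isChannel hK
  obtain ⟨o⟩ := ‹Nonempty X›
  have hsmul : ∀ c c' : ℂ, c • (1 : Matrix X X ℂ) = c' • 1 → c = c' := fun c c' h => by
    simpa using congrFun (congrFun h o) o
  have hMH : M.IsHermitian := by
    ext i j
    refine hsmul _ _ ?_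
    rw [← hM i j, Matrix.conjTranspose_apply, ← Matrix.conjTranspose_one,
      ← Matrix.conjTranspose_smul, ← hM j i, Matrix.conjTranspose_mul, Matrix.conjTranspose_conjTranspose]
  let U : Matrix (Fin s) (Fin s) ℂ := hMH.eigenvectorUnitary
  let μ := hMH.eigenvalues
  have hU : U * Uᴴ = 1 := Unitary.coe_mul_star_self hMH.eigenvectorUnitary
  have hUM : Uᴴ * M * U = Matrix.diagonal fun l => (μ l : ℂ) := by
    have := hMH.conjStarAlgAut_star_eigenvectorUnitary
    rw [Unitary.conjStarAlgAut_star_apply] at this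
    exact this
  let F : Fin s → Matrix Y Y ℂ := fun l => ∑ i, U i l • K i
  have hFgram : ∀ l l', (F l * W)ᴴ * (F l' * W) = if l = l' then (μ l : ℂ) • 1 else 0 := by
    intro l l'
    have h2 := congrFun (congrFun hUM l) l'
    rw [Matrix.diagonal_apply, Matrix.mul_assoc] at h2
    have h3 : (if l = l' then (μ l : ℂ) • (1 : Matrix X X ℂ) else 0) =
        (if l = l' then (μ l : ℂ) else 0) • 1 := by split_ifs <;> simp
    rw [h3, ← h2, Matrix.mul_apply]
    simp only [F, Matrix.sum_mul, Matrix.conjTranspose_sum, Matrix.mul_sum, Matrix.smul_mul,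
      Matrix.conjTranspose_smul, Matrix.mul_smul, hM, smul_smul, Matrix.mul_apply, Finset.mul_sum,
      Finset.sum_smul, Finset.smul_sum, Matrix.conjTranspose_apply]
    rw [Finset.sum_comm]
    refine Finset.sum_congr rfl fun i _ => Finset.sum_congr rfl fun j _ => ?_
    congr 1; ring
  have hμ : ∀ l, 0 ≤ μ l := fun l => by
    have h2 := (posSemidef_conjTranspose_mul_self (F l * W)).diag_nonneg (i := o)
    rw [hFgram, if_pos rfl] at h2
    simpa using h2
  have hF : krausMap F = krausMap K := by
    refine LinearMap.ext fun A => ?_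
    have h2 : ∀ i j, ∑ l, U i l * star (U j l) = if i = j then 1 else 0 := fun i j => by
      have := congrFun (congrFun hU i) j
      rwa [Matrix.mul_apply, Matrix.one_apply] at this
    calc ∑ l, F l * A * (F l)ᴴ
        = ∑ l, ∑ i, ∑ j, (U i l * star (U j l)) • (K i * A * (K j)ᴴ) := by
          refine Finset.sum_congr rfl fun l _ => ?_
          simp only [F, Matrix.sum_mul, Matrix.conjTranspose_sum, Matrix.mul_sum, Matrix.smul_mul,
            Matrix.conjTranspose_smul, Matrix.mul_smul, smul_smul, Finset.smul_sum]
          rw [Finset.sum_comm]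
          simp only [mul_comm]
      _ = ∑ i, ∑ j, (∑ l, U i l * star (U j l)) • (K i * A * (K j)ᴴ) := by
          rw [Finset.sum_comm]
          refine Finset.sum_congr rfl fun i _ => ?_
          rw [Finset.sum_comm]
          simp only [Finset.sum_smul]
      _ = ∑ i, K i * A * (K i)ᴴ := by
        simp only [h2, ite_smul, one_smul, zero_smul, Finset.sum_ite_eq, Finset.mem_univ, if_true]
  -- For `μ l = 0` the inverse is `0`, so errors that annihilate the code are left out.
  let R : Fin s → Matrix X Y ℂ := fun l => (((√(μ l))⁻¹ : ℝ) : ℂ) • (F l * W)ᴴ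
  have hRF : ∀ l l', R l * (F l' * W) = if l = l' then ((√(μ l) : ℝ) : ℂ) • 1 else 0 := by
    intro l l'
    simp only [R, Matrix.smul_mul, hFgram]
    split_ifs
    · rw [smul_smul, ← Complex.ofReal_mul]
      congr 2
      rw [inv_mul_eq_div, Real.div_sqrt]
    · simp
  have hproj : ∀ l l', (R l)ᴴ * R l * ((R l')ᴴ * R l') = if l = l' then (R l)ᴴ * R l else 0 := by
    intro l l'
    have h2 : (R l)ᴴ * R l * ((R l')ᴴ * R l') = (R l)ᴴ * (R l * (R l')ᴴ) * R l' := by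
      simp only [Matrix.mul_assoc]
    have h3 : R l * (R l')ᴴ = (((√(μ l'))⁻¹ : ℝ) : ℂ) • (R l * (F l' * W)) := by
      simp only [R, Matrix.conjTranspose_smul, Matrix.conjTranspose_conjTranspose, RCLike.star_def,
        Complex.conj_ofReal, Matrix.mul_smul]
    rw [h2, h3, hRF]
    split_ifs with h
    · subst h
      by_cases h0 : √(μ l) = 0
      · simp [R, h0]
      · rw [smul_smul, ← Complex.ofReal_mul, inv_mul_cancel₀ h0]
        simp
    · simp
  let Q := ∑ l, (R l)ᴴ * R l
  have hQ : Q * Q = Q := by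
    simp only [Q, Finset.sum_mul, Finset.mul_sum, hproj]
    simp
  have hQH : Qᴴ = Q := isHermitian_sum_gram R
  have hR : IsSubchannel (krausMap R) := by
    refine isSubchannel_krausMap ?_
    have : 1 - Q = (1 - Q)ᴴ * (1 - Q) := by
      rw [Matrix.conjTranspose_sub, Matrix.conjTranspose_one, hQH]
      calc 1 - Q = 1 - Q - Q + Q * Q := by rw [hQ]; abel
        _ = (1 - Q) * (1 - Q) := by noncomm_ring
    change (1 - Q).PosSemidef
    rw [this]
    exact posSemidef_conjTranspose_mul_self _
  have hS : IsSubchannel (krausMap fun _ : Unit => W) :=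
    isSubchannel_krausMap (by simpa [hW] using PosSemidef.zero)
  have htr : ∑ l, (μ l : ℂ) = 1 := by
    have h2 : M.trace = 1 := by
      refine hsmul _ _ ?_
      calc M.trace • (1 : Matrix X X ℂ) = ∑ i, (K i * W)ᴴ * (K i * W) := by
            simp only [hM, Matrix.trace, Finset.sum_smul, Matrix.diag_apply]
        _ = Wᴴ * (∑ i, (K i)ᴴ * K i) * W := by
            simp only [Matrix.conjTranspose_mul, Matrix.mul_assoc, Matrix.mul_sum, Matrix.sum_mul]
        _ = (1 : ℂ) • 1 := by rw [h1, Matrix.mul_one, hW, one_smul]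
    rw [← h2, hMH.trace_eq_sum_eigenvalues]
    rfl
  refine ⟨hK, _, _, hS, hR, ?_⟩
  rw [← hF, krausMap_comp, krausMap_comp]
  refine LinearMap.ext fun A => ?_
  rw [krausMap_apply, LinearMap.id_apply]
  calc ∑ q : Fin s × Fin s × Unit, R q.1 * (F q.2.1 * W) * A * (R q.1 * (F q.2.1 * W))ᴴ
      = ∑ l, ∑ l', if l = l' then (μ l : ℂ) • A else 0 := by
        rw [Fintype.sum_prod_type]
        refine Finset.sum_congr rfl fun l _ => ?_
        rw [Fintype.sum_prod_type]
        refine Finset.sum_congr rfl fun l' _ => ?_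
        rw [Fintype.sum_unique]
        simp only [hRF]
        split_ifs
        · rw [Matrix.conjTranspose_smul, Matrix.conjTranspose_one, Matrix.smul_mul, Matrix.one_mul,
            Matrix.mul_smul, Matrix.mul_one, smul_smul, RCLike.star_def, Complex.conj_ofReal,
            ← Complex.ofReal_mul, Real.mul_self_sqrt (hμ l)]
        · simp
    _ = A := by
        simp only [Finset.sum_ite_eq, Finset.mem_univ, if_true, ← Finset.sum_smul, htr, one_smul]

/-- Every channel of Choi rank at most `r` with `r⁴ dim X ≤ dim Y` is perfectly correctable. -/
theorem mem_perfRanks (hX : 2 ≤ Fintype.card X) {r : ℕ}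
    (hY : 0 < Fintype.card Y) (hr : r ^ 4 * Fintype.card X ≤ Fintype.card Y) :
    r ∈ perfRanks X Y := by
  intro E hE hrank
  have : Nonempty X := Fintype.card_pos_iff.1 (by omega)
  obtain ⟨m, K, hm, rfl⟩ := exists_krausMap hE.1.1
  have hmr := Nat.pow_le_pow_left (hm.trans_le hrank) 4
  have hlt : (Fintype.card X - 1) * m ^ 4 < Fintype.card Y := by
    rcases Nat.eq_zero_or_pos (m ^ 4) with h | h
    · rw [h]; omega
    · have := Nat.mul_le_mul_right (Fintype.card X) hmr
      have h2 : (Fintype.card X - 1) * m ^ 4 < Fintype.card X * m ^ 4 :=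
        Nat.mul_lt_mul_of_pos_right (by omega) h
      rw [mul_comm (Fintype.card X)] at h2
      omega
  obtain ⟨W, M, hW, hM⟩ := exists_isometry_gram_eq_smul (X := X)
    (sum_gram_eq_one_of_isChannel hE) hlt
  exact mem_perfCorrectable_of_gram_eq_smul hE hW hM

end

/-! ### A channel that is not perfectly correctable -/

section

variable {X Y : Type*} [Fintype X] [DecidableEq X] [Fintype Y] [DecidableEq Y]

/-- Knill–Laflamme conditions: if the channel with Kraus operators `K i` is perfectly correctable,
each Kraus operator `S k` of the encoding compresses all products `(K i)ᴴ * K j` to scalars. -/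
lemma exists_encoding_of_mem_perfCorrectable [Nonempty X] {ι : Type*} [Fintype ι]
    {K : ι → Matrix Y Y ℂ} (hK : krausMap K ∈ perfCorrectable X Y) :
    ∃ (m : ℕ) (S : Fin m → Matrix Y X ℂ), ∑ k, (S k)ᴴ * S k = 1 ∧
      ∀ k i j, ∃ c : ℂ, (K i * S k)ᴴ * (K j * S k) = c • 1 := by
  obtain ⟨hch, S, R, hS, hR, hp⟩ := hK
  obtain ⟨m, S, -, rfl⟩ := exists_krausMap hS.1
  obtain ⟨n, R, -, rfl⟩ := exists_krausMap hR.1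
  have hK1 := sum_gram_eq_one_of_isChannel hch
  rw [krausMap_comp, krausMap_comp] at hp
  have hid : IsChannel (krausMap fun p : Fin n × ι × Fin m => R p.1 * (K p.2.1 * S p.2.2)) := by
    refine ⟨⟨isCompletelyPositive_krausMap _, fun ρ hρ => ?_⟩, fun ρ hρ => ?_⟩
    · rw [hp, LinearMap.id_apply, hρ.2, Complex.one_re]
    · rw [hp, LinearMap.id_apply, hρ.2]
  have h1 := sum_gram_eq_one_of_isChannel hid
  have hp' := hp
  rw [← one_smul ℂ (LinearMap.id)] at hp'
  choose c hc using eq_smul_one_of_krausMap_eq_smul hp'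
  set G := ∑ l, (R l)ᴴ * R l with hG
  have hD := posSemidef_of_isSubchannel hR
  have hE := posSemidef_of_isSubchannel hS
  let T : ι × Fin m → Matrix X X ℂ := fun q => (K q.1 * S q.2)ᴴ * (1 - G) * (K q.1 * S q.2)
  have hT : ∀ q, (T q).PosSemidef := fun q => hD.conjTranspose_mul_mul_same _
  -- No trace can be lost: the two defects of trace preservation add up to zero.
  have hsum : ∑ q, T q + (1 - ∑ k, (S k)ᴴ * S k) = 0 := by
    have e1 : ∑ q : ι × Fin m, (K q.1 * S q.2)ᴴ * (K q.1 * S q.2) = ∑ k, (S k)ᴴ * S k := by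
      rw [Fintype.sum_prod_type_right]
      refine Finset.sum_congr rfl fun k _ => ?_
      conv_rhs => rw [← Matrix.mul_one (S k)ᴴ, ← hK1, Matrix.mul_sum, Matrix.sum_mul]
      simp only [Matrix.conjTranspose_mul, Matrix.mul_assoc]
    have e2 : ∑ q : ι × Fin m, (K q.1 * S q.2)ᴴ * G * (K q.1 * S q.2) = 1 := by
      rw [← h1]
      symm
      rw [Fintype.sum_prod_type_right]
      refine Finset.sum_congr rfl fun q _ => ?_
      simp only [hG, Matrix.mul_sum, Matrix.sum_mul, Matrix.conjTranspose_mul, Matrix.mul_assoc]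
    simp only [T, Matrix.mul_sub, Matrix.sub_mul, Matrix.mul_one, Finset.sum_sub_distrib, e1, e2]
    abel
  have htr := congrArg Matrix.trace hsum
  rw [Matrix.trace_add, Matrix.trace_zero, Matrix.trace_sum] at htr
  have ht0 : 0 ≤ ∑ q, (T q).trace := Finset.sum_nonneg fun q _ => (hT q).trace_nonneg
  obtain ⟨hT0, hS0⟩ := (add_eq_zero_iff_of_nonneg ht0 hE.trace_nonneg).1 htr
  rw [Finset.sum_eq_zero_iff_of_nonneg fun q _ => (hT q).trace_nonneg] at hT0
  have hGM : ∀ i k, G * (K i * S k) = K i * S k := fun i k => by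
    have h := (hT (i, k)).trace_eq_zero_iff.1 (hT0 (i, k) (Finset.mem_univ _))
    obtain ⟨m, B, -, hB⟩ := exists_mul_conjTranspose_of_posSemidef hD
    have h' : (Bᴴ * (K i * S k))ᴴ * (Bᴴ * (K i * S k)) = 0 := by
      rw [← h]
      simp only [T]
      rw [hB]
      simp only [Matrix.conjTranspose_mul, Matrix.conjTranspose_conjTranspose, Matrix.mul_assoc]
    rw [Matrix.conjTranspose_mul_self_eq_zero] at h'
    have h2 : (1 - G) * (K i * S k) = 0 := by rw [hB, Matrix.mul_assoc, h', Matrix.mul_zero]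
    rw [Matrix.sub_mul, Matrix.one_mul, sub_eq_zero] at h2
    exact h2.symm
  refine ⟨m, S, (sub_eq_zero.1 (hE.trace_eq_zero_iff.1 hS0)).symm, fun k i j =>
    ⟨∑ l, star (c (l, i, k)) * c (l, j, k), ?_⟩⟩
  rw [← hGM j k, hG, Matrix.sum_mul, Matrix.mul_sum, Finset.sum_smul]
  refine Finset.sum_congr rfl fun l _ => ?_
  have hi := hc (l, i, k)
  have hj := hc (l, j, k)
  simp only at hi hj
  calc (K i * S k)ᴴ * ((R l)ᴴ * R l * (K j * S k))
      = (R l * (K i * S k))ᴴ * (R l * (K j * S k)) := by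
        simp only [Matrix.conjTranspose_mul, Matrix.mul_assoc]
    _ = _ := by
        rw [hi, hj, Matrix.conjTranspose_smul, Matrix.conjTranspose_one, Matrix.smul_mul,
          Matrix.one_mul, smul_smul]

/-- The phase of the second entry of `tomographyVector`. -/
noncomputable def tomographyPhase {r : ℕ} (a : Fin r × Fin r) : ℂ :=
  if a.1 < a.2 then 1 else Complex.I

/-- Unit vectors of `ℂ^r` whose `r²` rank-one projections are linearly independent: the basis
vectors `e p`, and `3/5 e p + 4/5 e q`, `3/5 e q + 4/5 i e p` for `p < q`. Unequal weights are used
to avoid square roots. -/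
noncomputable def tomographyVector {r : ℕ} (a : Fin r × Fin r) (i : Fin r) : ℂ :=
  if a.1 = a.2 then (if i = a.1 then 1 else 0)
  else if i = a.1 then 3 / 5 else if i = a.2 then 4 / 5 * tomographyPhase a else 0

lemma sum_star_mul_tomographyVector {r : ℕ} (a : Fin r × Fin r) :
    ∑ i, star (tomographyVector a i) * tomographyVector a i = 1 := by
  obtain ⟨p, q⟩ := a
  by_cases hpq : p = q
  · subst hpq
    simp [tomographyVector]
  · have h : ∀ i, star (tomographyVector (p, q) i) * tomographyVector (p, q) i =
        (if i = p then (9 / 25 : ℂ) else 0) + if i = q then (16 / 25 : ℂ) else 0 := by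
      intro i
      by_cases hi : i = p
      · subst hi
        simp [tomographyVector, hpq]
        norm_num
      · by_cases hj : i = q
        · subst hj
          simp only [tomographyVector, tomographyPhase, hpq, hi, if_false, if_true]
          split_ifs
          · simp; norm_num
          · simp
            linear_combination (-16 / 25 : ℂ) * Complex.I_mul_I
        · simp [tomographyVector, hpq, hi, hj]
    simp only [h, Finset.sum_add_distrib, Finset.sum_ite_eq', Finset.mem_univ, if_true]
    norm_num

/-- A subspace that contains all the combinations of a family `D` with weights
`star (tomographyVector a i) * tomographyVector a j` contains the family. -/
lemma mem_of_sum_tomographyVector_mem {r : ℕ} {V : Type*} [AddCommGroup V] [Module ℂ V]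
    (L : Submodule ℂ V) (D : Fin r × Fin r → V)
    (h : ∀ i j, ∑ a, (star (tomographyVector a i) * tomographyVector a j) • D a ∈ L)
    (a : Fin r × Fin r) : D a ∈ L := by
  have hoff : ∀ i j, i < j → D (i, j) ∈ L ∧ D (j, i) ∈ L := by
    intro i j hij
    have hne : (i, j) ≠ (j, i) := fun h => hij.ne (Prod.ext_iff.1 h).1
    have key : ∀ k l : Fin r, (k = i ∧ l = j ∨ k = j ∧ l = i) →
        ∑ a, (star (tomographyVector a k) * tomographyVector a l) • D a =
        (star (tomographyVector (i, j) k) * tomographyVector (i, j) l) • D (i, j) +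
        (star (tomographyVector (j, i) k) * tomographyVector (j, i) l) • D (j, i) := by
      intro k l hkl
      rw [← Finset.sum_pair (f := fun a =>
        (star (tomographyVector a k) * tomographyVector a l) • D a) hne]
      refine (Finset.sum_subset (Finset.subset_univ _) fun a _ ha => ?_).symm
      obtain ⟨p, q⟩ := a
      simp only [Finset.mem_insert, Finset.mem_singleton, Prod.mk.injEq, not_or, not_and] at ha
      have : star (tomographyVector (p, q) k) * tomographyVector (p, q) l = 0 := by
        simp only [tomographyVector]
        rcases hkl with ⟨rfl, rfl⟩ | ⟨rfl, rfl⟩ <;> split_ifs <;> simp_all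
      rw [this, zero_smul]
    have h1 := h i j
    have h2 := h j i
    rw [key i j (by simp)] at h1
    rw [key j i (by simp)] at h2
    simp only [tomographyVector, tomographyPhase, hij.ne, hij.ne', hij, hij.not_gt, if_true,
      if_false, star_mul'] at h1 h2
    simp only [Complex.star_def, map_div₀, map_ofNat, Complex.conj_I, map_one] at h1 h2
    constructor
    · have h3 := L.smul_mem (25 / 24 : ℂ) (L.add_mem h1 h2)
      convert h3 using 1
      module
    · have h3 := L.smul_mem (25 / 24 * Complex.I : ℂ) (L.sub_mem h1 h2)
      convert h3 using 1
      have : D (j, i) = (-(Complex.I * Complex.I)) • D (j, i) := by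
        rw [Complex.I_mul_I]; simp
      conv_lhs => rw [this]
      module
  have hoff' : ∀ a : Fin r × Fin r, a.1 ≠ a.2 → D a ∈ L := fun a ha => by
    rcases lt_or_gt_of_ne ha with h | h
    · exact (hoff _ _ h).1
    · exact (hoff _ _ h).2
  by_cases ha : a.1 = a.2
  · have h1 := h a.1 a.1
    rw [← Finset.add_sum_erase _ _ (Finset.mem_univ a)] at h1
    have h2 : ∑ b ∈ Finset.univ.erase a,
        (star (tomographyVector b a.1) * tomographyVector b a.1) • D b ∈ L := by
      refine L.sum_mem fun b hb => ?_
      by_cases hb' : b.1 = b.2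
      · have : a.1 ≠ b.1 := fun h => (Finset.ne_of_mem_erase hb)
          (Prod.ext h.symm (by rw [← hb', ← ha, h]))
        simp [tomographyVector, hb', hb' ▸ this]
      · exact L.smul_mem _ (hoff' b hb')
    have h3 := (L.add_mem_iff_left h2).1 h1
    simpa [tomographyVector, ha] using h3
  · exact hoff' a ha

/-- If `r² (dim X - 1) ≥ dim Y`, some diagonal channel with `r` Kraus operators is not perfectly
correctable: the products `(K i)ᴴ * K j` span a decomposition of the identity into projections
of rank less than `dim X`. -/
theorem notMem_perfRanks (hX : 2 ≤ Fintype.card X) {r : ℕ}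
    (hr : Fintype.card Y ≤ r ^ 2 * (Fintype.card X - 1)) : r ∉ perfRanks X Y := by
  have : Nonempty X := Fintype.card_pos_iff.1 (by omega)
  obtain ⟨g⟩ : Nonempty (Y ↪ (Fin r × Fin r) × Fin (Fintype.card X - 1)) :=
    Function.Embedding.nonempty_of_card_le (by simpa [sq] using hr)
  let f : Y → Fin r × Fin r := fun y => (g y).1
  let K : Fin r → Matrix Y Y ℂ := fun i => Matrix.diagonal fun y => tomographyVector (f y) i
  have hch : IsChannel (krausMap K) := by
    refine isChannel_krausMap ?_
    simp only [K, Matrix.diagonal_conjTranspose, Matrix.diagonal_mul_diagonal]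
    ext y y'
    by_cases h : y = y'
    · subst h
      simpa [Matrix.sum_apply] using sum_star_mul_tomographyVector (f y)
    · simp [Matrix.sum_apply, h]
  intro hmem
  obtain ⟨m, S, hS, hc⟩ := exists_encoding_of_mem_perfCorrectable
    (hmem _ hch ((choiRank_krausMap_le _).trans (by simp)))
  have hS0 : ∀ k, (S k)ᴴ * S k = 0 := by
    intro k
    let P : Fin r × Fin r → Matrix Y Y ℂ := fun a =>
      Matrix.diagonal fun y => if f y = a then 1 else 0
    let D : Fin r × Fin r → Matrix X X ℂ := fun a => (S k)ᴴ * P a * S k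
    have hD : ∀ a, D a ∈ Submodule.span ℂ {(1 : Matrix X X ℂ)} := by
      refine mem_of_sum_tomographyVector_mem _ D fun i j => ?_
      obtain ⟨c, hc⟩ := hc k i j
      refine Submodule.mem_span_singleton.2 ⟨c, ?_⟩
      rw [← hc]
      have : (K i)ᴴ * K j = ∑ a, (star (tomographyVector a i) * tomographyVector a j) • P a := by
        ext y y'
        by_cases h : y = y'
        · subst h
          simp [K, P, Matrix.sum_apply, Matrix.diagonal_conjTranspose]
        · simp [K, P, Matrix.sum_apply, Matrix.diagonal_conjTranspose, h]
      rw [Matrix.conjTranspose_mul, Matrix.mul_assoc, ← Matrix.mul_assoc (K i)ᴴ, this,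
        Matrix.sum_mul, Matrix.mul_sum]
      refine Finset.sum_congr rfl fun a _ => ?_
      simp only [D, Matrix.smul_mul, Matrix.mul_smul, Matrix.mul_assoc]
    have hD0 : ∀ a, D a = 0 := by
      intro a
      obtain ⟨c, hc⟩ := Submodule.mem_span_singleton.1 (hD a)
      -- The `a`-th block has fewer than `dim X` rows, so `S k` has a kernel vector on it.
      let M : (X → ℂ) →ₗ[ℂ] ({y // f y = a} → ℂ) :=
        LinearMap.funLeft ℂ ℂ Subtype.val ∘ₗ (S k).mulVecLin
      have hlt : Module.finrank ℂ ({y // f y = a} → ℂ) < Module.finrank ℂ (X → ℂ) := by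
        rw [Module.finrank_fintype_fun_eq_card, Module.finrank_fintype_fun_eq_card]
        have : Fintype.card {y // f y = a} ≤ Fintype.card (Fin (Fintype.card X - 1)) :=
          Fintype.card_le_of_injective (fun y => (g y.1).2) fun y y' h =>
            Subtype.ext (g.injective (Prod.ext (y.2.trans y'.2.symm) h))
        rw [Fintype.card_fin] at this
        omega
      obtain ⟨x, hx, hx0⟩ := (Submodule.ne_bot_iff _).1
        (LinearMap.ker_ne_bot_of_finrank_lt (f := M) hlt)
      have hPS : P a *ᵥ (S k *ᵥ x) = 0 := by
        funext y
        rw [Matrix.mulVec_diagonal]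
        by_cases h : f y = a
        · have : (S k *ᵥ x) y = 0 := congrFun (LinearMap.mem_ker.1 hx) ⟨y, h⟩
          rw [this]; simp
        · simp [h]
      have : c • x = 0 := by
        have h1 : D a *ᵥ x = 0 := by
          change ((S k)ᴴ * P a * S k) *ᵥ x = 0
          rw [← Matrix.mulVec_mulVec, ← Matrix.mulVec_mulVec, hPS, Matrix.mulVec_zero]
        rwa [← hc, Matrix.smul_mulVec, Matrix.one_mulVec] at h1
      rw [← hc, (smul_eq_zero.1 this).resolve_right hx0, zero_smul]
    have hP : ∑ a, P a = 1 := by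
      ext y y'
      by_cases h : y = y'
      · subst h; simp [P, Matrix.sum_apply]
      · simp [P, Matrix.sum_apply, h]
    rw [← Matrix.mul_one (S k)ᴴ, ← hP, Matrix.mul_sum, Matrix.sum_mul]
    exact Finset.sum_eq_zero fun a _ => hD0 a
  simp [hS0] at hS

end

/-! ### Probabilistically correctable channels -/

section Compression

open Module

/-- If the rank of `T₀` is maximal on the pencil `T₀ + t • T`, then `T` maps the kernel of
`T₀` into the range of `T₀`. -/
lemma apply_mem_range_of_maximal_rank {E F : Type*} [AddCommGroup E] [Module ℂ E]
    [NormedAddCommGroup F] [NormedSpace ℂ F] [FiniteDimensional ℂ F] {T₀ T : E →ₗ[ℂ] F}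
    (h : ∀ t : ℂ, finrank ℂ (LinearMap.range (T₀ + t • T)) ≤ finrank ℂ (LinearMap.range T₀))
    {x : E} (hx : T₀ x = 0) : T x ∈ LinearMap.range T₀ := by
  by_contra hTx
  let b := finBasis ℂ (LinearMap.range T₀)
  choose y hy using fun i => (b i).2
  -- Lifts of a basis of the range, moved along the pencil, together with `T x`.
  let g : ℂ → Option (Fin (finrank ℂ (LinearMap.range T₀))) → F :=
    fun t o => o.elim (T x) fun i => T₀ (y i) + t • T (y i)
  have hb : LinearIndependent ℂ fun i => (b i : F) :=
    b.linearIndependent.map' (LinearMap.range T₀).subtype (Submodule.ker_subtype _)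
  have hspan : Submodule.span ℂ (Set.range fun i => (b i : F)) = LinearMap.range T₀ := by
    have := congrArg (Submodule.map (LinearMap.range T₀).subtype) b.span_eq
    rw [Submodule.map_span, ← Set.range_comp, Submodule.map_top, Submodule.range_subtype] at this
    exact this
  have h0 : LinearIndependent ℂ (g 0) := by
    rw [linearIndependent_option]
    have : (g 0 ∘ fun i : Fin _ => (some i : Option _)) = fun i => (b i : F) := by
      funext i; simp [g, hy]
    refine ⟨by rw [this]; exact hb, ?_⟩
    rw [this, hspan]
    exact hTx
  have hcont : Continuous g := by
    refine continuous_pi fun o => ?_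
    cases o with
    | none => exact continuous_const
    | some i => exact continuous_const.add (continuous_id.smul continuous_const)
  have hev := hcont.continuousAt.eventually h0.eventually
  obtain ⟨t, ht, ht0⟩ := ((hev.filter_mono nhdsWithin_le_nhds).and
    (self_mem_nhdsWithin (s := {(0 : ℂ)}ᶜ))).exists
  have hmem : ∀ o, g t o ∈ LinearMap.range (T₀ + t • T) := by
    intro o
    cases o with
    | none => exact ⟨t⁻¹ • x, by
        have : t ≠ 0 := ht0
        simp [g, hx, smul_smul, this]⟩
    | some i => exact ⟨y i, by simp [g]⟩
  have hli : LinearIndependent ℂ fun o => (⟨g t o, hmem o⟩ : LinearMap.range (T₀ + t • T)) :=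
    LinearIndependent.of_comp (LinearMap.range (T₀ + t • T)).subtype ht
  have := hli.fintype_card_le_finrank
  rw [Fintype.card_option, Fintype.card_fin] at this
  have := h t
  omega

/-- The map `e ↦ ∑ b, e b (s b)`, whose range is spanned by the images of the vectors `s b`
under the operators in `𝓔`. -/
def evalSum {U F X : Type*} [Fintype X] [AddCommGroup U] [Module ℂ U] [AddCommGroup F] [Module ℂ F]
    (𝓔 : Submodule ℂ (U →ₗ[ℂ] F)) (s : X → U) : (X → 𝓔) →ₗ[ℂ] F :=
  ∑ b, LinearMap.applyₗ (s b) ∘ₗ 𝓔.subtype ∘ₗ LinearMap.proj b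

lemma evalSum_apply {U F X : Type*} [Fintype X] [AddCommGroup U] [Module ℂ U] [AddCommGroup F]
    [Module ℂ F] (𝓔 : Submodule ℂ (U →ₗ[ℂ] F)) (s : X → U) (e : X → 𝓔) :
    evalSum 𝓔 s e = ∑ b, (e b : U →ₗ[ℂ] F) (s b) := by
  simp [evalSum, LinearMap.sum_apply]

/-- A jointly injective space `𝓔` of operators of dimension at most `r` on a large space `U` can be
compressed to multiples of the identity on `ℂ^X`, not all zero. The induction step from `r - 1` to
`r` may cost `r * dim X - 1` dimensions of `U`; `dim U` has to exceed the sum of these. -/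
theorem exists_compression_eq_smul_id {F X : Type*} [NormedAddCommGroup F] [NormedSpace ℂ F]
    [FiniteDimensional ℂ F] [Fintype X] [DecidableEq X] [Nonempty X] (r : ℕ) :
    ∀ (U : Type*) [AddCommGroup U] [Module ℂ U] [FiniteDimensional ℂ U]
      (𝓔 : Submodule ℂ (U →ₗ[ℂ] F)), finrank ℂ 𝓔 ≤ r →
      (∀ u, (∀ E ∈ 𝓔, E u = 0) → u = 0) →
      r * (r + 1) * Fintype.card X + 2 ≤ 2 * finrank ℂ U + 2 * r →
      ∃ (S : (X → ℂ) →ₗ[ℂ] U) (R : F →ₗ[ℂ] (X → ℂ)),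
        (∀ E ∈ 𝓔, ∃ c : ℂ, R ∘ₗ E ∘ₗ S = c • LinearMap.id) ∧ ∃ E ∈ 𝓔, R ∘ₗ E ∘ₗ S ≠ 0 := by
  induction r with
  | zero =>
    intro U _ _ _ 𝓔 h𝓔 hinj hdim
    exfalso
    have h0 : 𝓔 = ⊥ := Submodule.finrank_eq_zero.1 (Nat.le_zero.1 h𝓔)
    have : Subsingleton U := ⟨fun a b => by
      rw [hinj a (by simp [h0]), hinj b (by simp [h0])]⟩
    have := finrank_zero_of_subsingleton (R := ℂ) (M := U)
    omega
  | succ r ih =>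
    intro U _ _ _ 𝓔 h𝓔 hinj hdim
    have hX : 0 < Fintype.card X := Fintype.card_pos
    -- Choose the code vectors `s` so that the error images span as much as possible.
    obtain ⟨s, hs⟩ : ∃ s : X → U, ∀ s', finrank ℂ (LinearMap.range (evalSum 𝓔 s')) ≤
        finrank ℂ (LinearMap.range (evalSum 𝓔 s)) := by
      have hb : BddAbove (Set.range fun s : X → U => finrank ℂ (LinearMap.range (evalSum 𝓔 s))) :=
        ⟨finrank ℂ F, by rintro _ ⟨s, rfl⟩; exact Submodule.finrank_le _⟩
      obtain ⟨s, hs⟩ := Nat.sSup_mem (Set.range_nonempty _) hb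
      exact ⟨s, fun s' => hs ▸ le_csSup hb ⟨s', rfl⟩⟩
    by_cases hker : LinearMap.ker (evalSum 𝓔 s) = ⊥
    · obtain ⟨L, hL⟩ := LinearMap.exists_leftInverse_of_injective _ hker
      have hU : 0 < finrank ℂ U := by
        have := Nat.le_mul_of_pos_right ((r + 1) * (r + 1 + 1)) hX
        nlinarith
      have : Nontrivial U := nontrivial_of_finrank_pos hU
      obtain ⟨u, hu⟩ := exists_ne (0 : U)
      obtain ⟨E₀, hE₀, hne⟩ : ∃ E ∈ 𝓔, E ≠ 0 := by
        by_contra! hc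
        exact hu (hinj u fun E hE => by rw [hc E hE]; rfl)
      obtain ⟨φ, hφ⟩ := Module.Projective.exists_dual_ne_zero ℂ
        (x := (⟨E₀, hE₀⟩ : 𝓔)) (fun h => hne (congrArg Subtype.val h))
      let S : (X → ℂ) →ₗ[ℂ] U := Fintype.linearCombination ℂ s
      let R : F →ₗ[ℂ] (X → ℂ) := LinearMap.pi fun b => φ ∘ₗ LinearMap.proj b ∘ₗ L
      have hRES : ∀ E (hE : E ∈ 𝓔), R ∘ₗ E ∘ₗ S = φ ⟨E, hE⟩ • LinearMap.id := by
        intro E hE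
        refine LinearMap.ext fun x => funext fun b => ?_
        have h1 : E (S x) = evalSum 𝓔 s fun b => x b • ⟨E, hE⟩ := by
          simp [S, evalSum_apply, Fintype.linearCombination_apply]
        have h2 := LinearMap.congr_fun hL fun b => x b • (⟨E, hE⟩ : 𝓔)
        simp only [LinearMap.comp_apply, LinearMap.id_apply] at h2
        simp only [R, LinearMap.comp_apply, LinearMap.pi_apply, LinearMap.proj_apply, h1, h2,
          map_smul, LinearMap.smul_apply, LinearMap.id_apply, Pi.smul_apply, smul_eq_mul]
        exact mul_comm _ _
      refine ⟨S, R, fun E hE => ⟨_, hRES E hE⟩, E₀, hE₀, ?_⟩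
      rw [hRES E₀ hE₀]
      exact smul_ne_zero hφ one_ne_zero
    -- A relation among the error images yields an operator `G` of rank less than `(r + 1) * dim X`.
    · obtain ⟨e, he, hne⟩ := (Submodule.ne_bot_iff _).1 hker
      obtain ⟨b, hb⟩ : ∃ b, e b ≠ 0 := Function.ne_iff.1 hne
      let G : U →ₗ[ℂ] F := e b
      have hG : LinearMap.range G ≤ LinearMap.range (evalSum 𝓔 s) := by
        rintro _ ⟨u, rfl⟩
        have h := apply_mem_range_of_maximal_rank (T₀ := evalSum 𝓔 s)
          (T := evalSum 𝓔 (Pi.single b u : X → U)) (fun t => ?_) he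
        · rw [evalSum_apply, Finset.sum_eq_single b] at h
          · simpa using h
          · intro a _ hab; simp [hab]
          · simp
        · have : evalSum 𝓔 s + t • evalSum 𝓔 (Pi.single b u : X → U) =
              evalSum 𝓔 (s + t • (Pi.single b u : X → U)) := by
            refine LinearMap.ext fun x => ?_
            simp [evalSum_apply, Finset.sum_add_distrib, Finset.smul_sum]
          rw [this]
          exact hs _
      have hrank : finrank ℂ (LinearMap.range G) + 1 ≤ (r + 1) * Fintype.card X := by
        have h1 := Submodule.finrank_mono hG
        have h2 := LinearMap.finrank_range_add_finrank_ker (evalSum 𝓔 s)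
        have h3 : 0 < finrank ℂ (LinearMap.ker (evalSum 𝓔 s)) := by
          rw [Nat.pos_iff_ne_zero]
          exact fun h => hker (Submodule.finrank_eq_zero.1 h)
        rw [finrank_pi_fintype, Finset.sum_const, smul_eq_mul, Finset.card_univ] at h2
        have h4 := Nat.mul_le_mul_left (Fintype.card X) h𝓔
        rw [mul_comm (r + 1)]
        omega
      have hkerG := LinearMap.finrank_range_add_finrank_ker G
      let ρ : (U →ₗ[ℂ] F) →ₗ[ℂ] (LinearMap.ker G →ₗ[ℂ] F) :=
        LinearMap.lcomp ℂ F (LinearMap.ker G).subtype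
      have hρ : finrank ℂ (𝓔.map ρ) ≤ r := by
        have h1 := LinearMap.finrank_range_add_finrank_ker (ρ.domRestrict 𝓔)
        rw [LinearMap.range_domRestrict] at h1
        have h2 : 0 < finrank ℂ (LinearMap.ker (ρ.domRestrict 𝓔)) := by
          rw [Nat.pos_iff_ne_zero]
          intro h
          have h3 : e b ∈ LinearMap.ker (ρ.domRestrict 𝓔) := by
            rw [LinearMap.mem_ker]
            ext u
            exact u.2
          rw [Submodule.finrank_eq_zero.1 h] at h3
          exact hb ((Submodule.mem_bot ℂ).1 h3)
        omega
      obtain ⟨S, R, h1, E, hE, h2⟩ := ih (LinearMap.ker G) (𝓔.map ρ) hρ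
        (fun u hu => by
          refine Subtype.ext (hinj u fun E hE => ?_)
          exact hu (ρ E) (Submodule.mem_map_of_mem hE))
        (by nlinarith)
      refine ⟨(LinearMap.ker G).subtype ∘ₗ S, R, fun E hE => ?_, ?_⟩
      · exact h1 (ρ E) (Submodule.mem_map_of_mem hE)
      · obtain ⟨E', hE', rfl⟩ := hE
        exact ⟨E', hE', h2⟩

end Compression

section

variable {X Y : Type*} [Fintype X] [DecidableEq X] [Fintype Y] [DecidableEq Y]

open scoped MatrixOrder Matrix.Norms.L2Operator in
lemma exists_smul_contraction (A : Matrix Y X ℂ) :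
    ∃ t : ℂ, t ≠ 0 ∧ (1 - (t • A)ᴴ * (t • A)).PosSemidef := by
  have h := IsSelfAdjoint.le_algebraMap_norm_self (a := Aᴴ * A)
    (isHermitian_conjTranspose_mul_self A)
  rw [Matrix.le_iff] at h
  set N : ℝ := ‖Aᴴ * A‖
  have hN : 0 ≤ N := norm_nonneg _
  have hs : 0 < √(N + 1) := Real.sqrt_pos.2 (by linarith)
  refine ⟨((√(N + 1))⁻¹ : ℝ), by exact_mod_cast inv_ne_zero hs.ne', ?_⟩
  have hsq : ((((√(N + 1))⁻¹ : ℝ) : ℂ)) * (((√(N + 1))⁻¹ : ℝ) : ℂ) = ((N + 1)⁻¹ : ℝ) := by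
    rw [← Complex.ofReal_mul, ← mul_inv, Real.mul_self_sqrt (by linarith)]
  have h1 : (1 - ((((√(N + 1))⁻¹ : ℝ) : ℂ) • A)ᴴ * ((((√(N + 1))⁻¹ : ℝ) : ℂ) • A)) =
      (((N + 1)⁻¹ : ℝ) : ℂ) • (algebraMap ℝ (Matrix X X ℂ) N - Aᴴ * A) +
        (((N + 1)⁻¹ : ℝ) : ℂ) • (1 : Matrix X X ℂ) := by
    rw [Matrix.conjTranspose_smul, Matrix.smul_mul, Matrix.mul_smul, smul_smul, RCLike.star_def,
      Complex.conj_ofReal, hsq, smul_sub, sub_add_eq_add_sub]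
    congr 1
    rw [IsScalarTower.algebraMap_apply ℝ ℂ (Matrix X X ℂ), Algebra.algebraMap_eq_smul_one,
      smul_smul, ← add_smul]
    have : (((N + 1)⁻¹ : ℝ) : ℂ) * (N : ℂ) + (((N + 1)⁻¹ : ℝ) : ℂ) = 1 := by
      have h2 : (N + 1)⁻¹ * N + (N + 1)⁻¹ = 1 := by field_simp
      exact_mod_cast h2
    exact (by rw [show (algebraMap ℝ ℂ) N = (N : ℂ) from rfl, this, one_smul])
  have h0 : (0 : ℂ) ≤ (((N + 1)⁻¹ : ℝ) : ℂ) := by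
    exact_mod_cast inv_nonneg.2 (by linarith : (0 : ℝ) ≤ N + 1)
  rw [h1]
  exact (h.smul h0).add (PosSemidef.one.smul h0)

/-- Every matrix is, up to a nonzero factor, the only Kraus operator of a subchannel. -/
lemma exists_smul_isSubchannel (A : Matrix Y X ℂ) :
    ∃ t : ℂ, t ≠ 0 ∧ IsSubchannel (krausMap fun _ : Unit => t • A) := by
  obtain ⟨t, ht, h⟩ := exists_smul_contraction A
  exact ⟨t, ht, isSubchannel_krausMap (by simpa using h)⟩

/-- A channel is probabilistically correctable as soon as its Kraus operators can be compressed to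
multiples of the identity that do not all vanish. -/
lemma mem_probCorrectable_of_mul_mul_eq_smul {ι : Type*} [Fintype ι] {K : ι → Matrix Y Y ℂ}
    (hK : IsChannel (krausMap K)) (S : Matrix Y X ℂ) (R : Matrix X Y ℂ)
    (h : ∀ i, ∃ c : ℂ, R * K i * S = c • 1) {i₀ : ι} (h₀ : R * K i₀ * S ≠ 0) :
    krausMap K ∈ probCorrectable X Y := by
  choose c hc using h
  obtain ⟨t, ht, hS⟩ := exists_smul_isSubchannel S
  obtain ⟨u, hu, hR⟩ := exists_smul_isSubchannel R
  have hX : Nonempty X := by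
    by_contra hX
    rw [not_nonempty_iff] at hX
    exact h₀ (by ext a; exact hX.elim a)
  have hc0 : c i₀ ≠ 0 := fun h => h₀ (by rw [hc, h, zero_smul])
  have key : krausMap (fun _ : Unit => u • R) ∘ₗ krausMap K ∘ₗ krausMap (fun _ : Unit => t • S) =
      (∑ i, (u * t * c i) * star (u * t * c i)) • LinearMap.id := by
    rw [krausMap_comp, krausMap_comp]
    refine LinearMap.ext fun A => ?_
    rw [krausMap_apply, LinearMap.smul_apply, LinearMap.id_apply, Finset.sum_smul,
      Fintype.sum_prod_type, Fintype.sum_unique, Fintype.sum_prod_type]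
    refine Finset.sum_congr rfl fun i _ => ?_
    have : (u • R) * (K i * (t • S)) = (u * t * c i) • (1 : Matrix X X ℂ) := by
      rw [Matrix.mul_smul, Matrix.smul_mul, Matrix.mul_smul, ← Matrix.mul_assoc, hc, smul_smul,
        smul_smul]
    simp only [Fintype.sum_unique]
    rw [this]
    simp only [Matrix.conjTranspose_smul, Matrix.smul_mul, Matrix.one_mul,
      Matrix.conjTranspose_one, Matrix.mul_smul, Matrix.mul_one, smul_smul]
    rw [mul_comm]
  refine ⟨hK, _, _, hS, hR, ?_, _, key⟩
  rw [key]
  refine smul_ne_zero (fun h => ?_) one_ne_zero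
  rw [Finset.sum_eq_zero_iff_of_nonneg fun i _ => mul_star_self_nonneg _] at h
  have := h i₀ (Finset.mem_univ _)
  simp [ht, hu, hc0] at this

/-- Every channel of Choi rank at most `r < √(dim Y / (dim X - 1))` is probabilistically
correctable. -/
theorem mem_probRanks (hX : 2 ≤ Fintype.card X) {r : ℕ}
    (hr : r ^ 2 * (Fintype.card X - 1) < Fintype.card Y) : r ∈ probRanks X Y := by
  intro E hE hrank
  have : Nonempty X := Fintype.card_pos_iff.1 (by omega)
  obtain ⟨m, K, hm, rfl⟩ := exists_krausMap hE.1.1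
  have h1 := sum_gram_eq_one_of_isChannel hE
  let 𝓔 := Submodule.span ℂ (Set.range fun i => (K i).toLin')
  have hinj : ∀ u : Y → ℂ, (∀ E ∈ 𝓔, E u = 0) → u = 0 := fun u hu => by
    have h2 : (∑ i, (K i)ᴴ * K i) *ᵥ u = 0 := by
      rw [Matrix.sum_mulVec]
      refine Finset.sum_eq_zero fun i _ => ?_
      have := hu _ (Submodule.subset_span ⟨i, rfl⟩)
      rw [Matrix.toLin'_apply] at this
      rw [← Matrix.mulVec_mulVec, this, Matrix.mulVec_zero]
    rwa [h1, Matrix.one_mulVec] at h2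
  have hdim : r * (r + 1) * Fintype.card X + 2 ≤ 2 * Module.finrank ℂ (Y → ℂ) + 2 * r := by
    rw [Module.finrank_fintype_fun_eq_card]
    obtain ⟨d, hd⟩ := Nat.exists_eq_add_of_le hX
    rw [hd] at hr ⊢
    have : 2 + d - 1 = d + 1 := by omega
    rw [this] at hr
    have : r ≤ r * r := Nat.le_mul_self r
    have := Nat.mul_le_mul_right d this
    nlinarith
  obtain ⟨S, R, hc, hne⟩ := exists_compression_eq_smul_id (F := Y → ℂ) (X := X) r (Y → ℂ) 𝓔
    ((finrank_range_le_card _).trans (by simpa [hm] using hrank)) hinj hdim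
  have hmat : ∀ i, LinearMap.toMatrix' (R ∘ₗ (K i).toLin' ∘ₗ S) =
      LinearMap.toMatrix' R * K i * LinearMap.toMatrix' S := fun i => by
    rw [LinearMap.toMatrix'_comp, LinearMap.toMatrix'_comp, LinearMap.toMatrix'_toLin',
      Matrix.mul_assoc]
  obtain ⟨i₀, hi₀⟩ : ∃ i, R ∘ₗ (K i).toLin' ∘ₗ S ≠ 0 := by
    by_contra! hz
    obtain ⟨E, hE, hne⟩ := hne
    refine hne ?_
    clear hne
    induction hE using Submodule.span_induction with
    | mem x hx => obtain ⟨i, rfl⟩ := hx; exact hz i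
    | zero => simp
    | add x y _ _ hx hy =>
      have : R ∘ₗ (x + y) ∘ₗ S = R ∘ₗ x ∘ₗ S + R ∘ₗ y ∘ₗ S := by ext; simp
      rw [this, hx, hy, add_zero]
    | smul a x _ hx =>
      have : R ∘ₗ (a • x) ∘ₗ S = a • R ∘ₗ x ∘ₗ S := by ext; simp
      rw [this, hx, smul_zero]
  refine mem_probCorrectable_of_mul_mul_eq_smul hE (LinearMap.toMatrix' S)
    (LinearMap.toMatrix' R) (fun i => ?_) (i₀ := i₀) ?_
  · obtain ⟨c, hc⟩ := hc _ (Submodule.subset_span ⟨i, rfl⟩)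
    exact ⟨c, by rw [← hmat, hc, map_smul, LinearMap.toMatrix'_id]⟩
  · rw [← hmat]
    simpa using hi₀

end

/-! ### A channel that is not probabilistically correctable -/

section

variable {X Y : Type*} [Fintype X] [DecidableEq X] [Fintype Y] [DecidableEq Y]

/-- The converse of `mem_probCorrectable_of_mul_mul_eq_smul`. -/
lemma exists_mul_mul_eq_smul_of_mem_probCorrectable [Nonempty X] {ι : Type*} [Fintype ι]
    {K : ι → Matrix Y Y ℂ} (hK : krausMap K ∈ probCorrectable X Y) :
    ∃ (S : Matrix Y X ℂ) (R : Matrix X Y ℂ) (c : ι → ℂ) (i₀ : ι),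
      (∀ i, R * K i * S = c i • 1) ∧ c i₀ ≠ 0 := by
  obtain ⟨-, S, R, hS, hR, hne, p, hp⟩ := hK
  obtain ⟨m, S, -, rfl⟩ := exists_krausMap hS.1
  obtain ⟨n, R, -, rfl⟩ := exists_krausMap hR.1
  rw [krausMap_comp, krausMap_comp] at hp hne
  choose c hc using eq_smul_one_of_krausMap_eq_smul hp
  obtain ⟨⟨l, i₀, k⟩, h⟩ : ∃ q, c q ≠ 0 := by
    by_contra! h
    refine hne (LinearMap.ext fun A => ?_)
    rw [krausMap_apply]
    refine Finset.sum_eq_zero fun q _ => ?_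
    rw [hc, h]
    simp
  exact ⟨S k, R l, fun i => c (l, i, k), i₀, fun i => by rw [Matrix.mul_assoc]; exact hc (l, i, k),
    h⟩

/-- A subspace of `ℂ^P` of dimension at least `|Y|` contains an orthonormal family indexed
by `Y`. -/
lemma exists_orthonormal_mem {P : Type*} [Fintype P] [DecidableEq P] (H : Submodule ℂ (P → ℂ))
    (hH : Fintype.card Y ≤ Module.finrank ℂ H) :
    ∃ v : Y → P → ℂ, (∀ y, v y ∈ H) ∧
      ∀ y y', star (v y) ⬝ᵥ v y' = if y = y' then 1 else 0 := by
  let e := WithLp.linearEquiv 2 ℂ (P → ℂ)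
  let H' : Submodule ℂ (EuclideanSpace ℂ P) := H.comap e.toLinearMap
  have hf : Module.finrank ℂ H' = Module.finrank ℂ H :=
    (LinearEquiv.ofSubmodule' e H).finrank_eq
  let b := stdOrthonormalBasis ℂ H'
  obtain ⟨g⟩ : Nonempty (Y ↪ Fin (Module.finrank ℂ H')) :=
    Function.Embedding.nonempty_of_card_le (by simpa [hf] using hH)
  refine ⟨fun y => e (b (g y)), fun y => (b (g y)).2, fun y y' => ?_⟩
  have h := orthonormal_iff_ite.1 b.orthonormal (g y) (g y')
  rw [Submodule.coe_inner, EuclideanSpace.inner_eq_star_dotProduct] at h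
  simp only [g.injective.eq_iff] at h
  rw [dotProduct_comm]
  exact h

/-- If `r` is at least `dim Y * dim X / ((dim X)² - 1)`, some channel with `r` Kraus operators is
not probabilistically correctable. It is an isometry `ℂ^Y → ℂ^r ⊗ ℂ^X`, followed by the
partial trace over `ℂ^r` and an embedding of `ℂ^X` in `ℂ^Y`; the range of the isometry lies in a
subspace that contains no `c ⊗ ℂ^X` with `c ≠ 0`. -/
theorem notMem_probRanks (hX : 2 ≤ Fintype.card X) (hXY : Fintype.card X ≤ Fintype.card Y) {r : ℕ}
    (hr : Fintype.card Y * Fintype.card X + r ≤ r * Fintype.card X ^ 2) :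
    r ∉ probRanks X Y := by
  have : Nonempty X := Fintype.card_pos_iff.1 (by omega)
  obtain ⟨m, hm⟩ : ∃ m, r * Fintype.card X = Fintype.card Y + m := by
    refine Nat.exists_eq_add_of_le (Nat.le_of_mul_le_mul_right (c := Fintype.card X) ?_ (by omega))
    nlinarith
  -- Each of the `m` equations that cut out the subspace excludes up to `dim X` of the `c i`.
  obtain ⟨J⟩ : Nonempty (Fin r ↪ Fin m × X) := by
    refine Function.Embedding.nonempty_of_card_le ?_
    rw [Fintype.card_fin, Fintype.card_prod, Fintype.card_fin]
    nlinarith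
  obtain ⟨g⟩ : Nonempty (X ↪ Y) := Function.Embedding.nonempty_of_card_le hXY
  let Λ : (Fin r × X → ℂ) →ₗ[ℂ] (Fin m → ℂ) :=
    LinearMap.pi fun k => ∑ i, if (J i).1 = k then LinearMap.proj (i, (J i).2) else 0
  have hΛ : ∀ z k, Λ z k = ∑ i, if (J i).1 = k then z (i, (J i).2) else 0 := by
    intro z k
    simp only [Λ, LinearMap.pi_apply, LinearMap.sum_apply]
    refine Finset.sum_congr rfl fun i _ => ?_
    split_ifs <;> rfl
  have hH : Fintype.card Y ≤ Module.finrank ℂ (LinearMap.ker Λ) := by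
    have h1 := LinearMap.finrank_range_add_finrank_ker Λ
    have h2 := Submodule.finrank_le (LinearMap.range Λ)
    rw [Module.finrank_fintype_fun_eq_card, Fintype.card_fin] at h2
    rw [Module.finrank_fintype_fun_eq_card, Fintype.card_prod, Fintype.card_fin] at h1
    omega
  obtain ⟨v, hv, hon⟩ := exists_orthonormal_mem (Y := Y) _ hH
  let P : Matrix Y X ℂ := Matrix.of fun y a => if y = g a then 1 else 0
  let V : Fin r → Matrix X Y ℂ := fun i => Matrix.of fun a y => v y (i, a)
  have hP : Pᴴ * P = 1 := by
    ext a b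
    simp only [P, Matrix.mul_apply, Matrix.conjTranspose_apply, Matrix.of_apply, Matrix.one_apply]
    rw [Finset.sum_eq_single (g a)]
    · simp [g.injective.eq_iff]
    · intro y _ hy; simp [hy]
    · simp
  have hch : IsChannel (krausMap fun i => P * V i) := by
    refine isChannel_krausMap ?_
    have : ∀ i, (P * V i)ᴴ * (P * V i) = (V i)ᴴ * V i := fun i => by
      rw [Matrix.conjTranspose_mul, Matrix.mul_assoc, ← Matrix.mul_assoc Pᴴ, hP, Matrix.one_mul]
    simp only [this]
    ext y y'
    rw [Matrix.one_apply, ← hon y y', Matrix.sum_apply, dotProduct, Fintype.sum_prod_type]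
    rfl
  intro hmem
  obtain ⟨S, R, c, i₀, hc, hi₀⟩ := exists_mul_mul_eq_smul_of_mem_probCorrectable
    (hmem _ hch ((choiRank_krausMap_le _).trans (by simp)))
  let A := R * P
  have hA : ∀ i, A * (V i * S) = c i • 1 := fun i => by
    rw [← hc i]; simp only [A, Matrix.mul_assoc]
  have hBA : ((c i₀)⁻¹ • (V i₀ * S)) * A = 1 := by
    rw [mul_eq_one_comm, Matrix.mul_smul, hA, smul_smul, inv_mul_cancel₀ hi₀, one_smul]
  have hVu : ∀ i, V i * (S * A) = c i • 1 := fun i => by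
    calc V i * (S * A) = 1 * (V i * S) * A := by rw [Matrix.one_mul, Matrix.mul_assoc]
      _ = c i • 1 := by
        rw [← hBA, Matrix.mul_assoc _ A, hA, Matrix.mul_smul, Matrix.mul_one, Matrix.smul_mul, hBA]
  -- The isometry maps the column `(J i₀).2` of `S * A` to `c ⊗ e (J i₀).2`, on which the equation
  -- `(J i₀).1` takes the value `c i₀`.
  let z : Fin r × X → ℂ := ∑ y, (S * A) y (J i₀).2 • v y
  have hz : z ∈ LinearMap.ker Λ := Submodule.sum_mem _ fun y _ => Submodule.smul_mem _ _ (hv y)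
  have hz' : ∀ i b, z (i, b) = if b = (J i₀).2 then c i else 0 := fun i b => by
    have := congrFun (congrFun (hVu i) b) (J i₀).2
    rw [Matrix.mul_apply, Matrix.smul_apply, Matrix.one_apply, smul_eq_mul, mul_ite, mul_one,
      mul_zero] at this
    rw [← this]
    simp [z, V, Finset.sum_apply, mul_comm]
  have h0 := congrFun (LinearMap.mem_ker.1 hz) (J i₀).1
  rw [hΛ, Finset.sum_eq_single i₀] at h0
  · rw [if_pos rfl, hz', if_pos rfl] at h0
    exact hi₀ h0
  · intro i _ hi
    split_ifs with h
    · rw [hz', if_neg fun h' => hi (J.injective (Prod.ext h h'))]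
    · rfl
  · simp

end

end PQEC

/-! ### The bounds -/

theorem theorem5 (X Y : Type*) [Fintype X] [DecidableEq X] [Fintype Y] [DecidableEq Y]
    (hX : 2 ≤ Fintype.card X) (hXY : Fintype.card X ≤ Fintype.card Y) :
    -- both maxima are attained
    IsGreatest (PQEC.perfRanks X Y) (PQEC.rPerf X Y) ∧
    IsGreatest (PQEC.probRanks X Y) (PQEC.rProb X Y) ∧
    ⌊((Fintype.card Y : ℝ) / (Fintype.card X : ℝ)) ^ (1 / 4 : ℝ)⌋ ≤ (PQEC.rPerf X Y : ℤ) ∧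
    (PQEC.rPerf X Y : ℤ) ≤ ⌈√((Fintype.card Y : ℝ) / ((Fintype.card X : ℝ) - 1))⌉ - 1 ∧
    ⌈√((Fintype.card Y : ℝ) / ((Fintype.card X : ℝ) - 1))⌉ - 1 ≤ (PQEC.rProb X Y : ℤ) ∧
    (PQEC.rProb X Y : ℝ) <
      (Fintype.card Y : ℝ) * (Fintype.card X : ℝ) / ((Fintype.card X : ℝ) ^ 2 - 1) := by
  set d := Fintype.card X with hd
  set n := Fintype.card Y with hn
  have hd2 : (2 : ℝ) ≤ d := by exact_mod_cast hX
  have hn0 : (0 : ℝ) < n := by exact_mod_cast (by omega : 0 < n)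
  have hd1 : ((d - 1 : ℕ) : ℝ) = d - 1 := by rw [Nat.cast_sub (by omega), Nat.cast_one]
  have hq : (0 : ℝ) < n / (d - 1) := div_pos hn0 (by linarith)
  have hkpos : 0 < ⌈√((n : ℝ) / ((d : ℝ) - 1))⌉ := Int.ceil_pos.2 (Real.sqrt_pos.2 hq)
  have hperf : ∀ r ∈ PQEC.perfRanks X Y, (r : ℤ) ≤ ⌈√((n : ℝ) / ((d : ℝ) - 1))⌉ - 1 := by
    intro r hr
    by_contra! hlt
    refine PQEC.notMem_perfRanks hX (r := r) ?_ hr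
    have h1 : √((n : ℝ) / ((d : ℝ) - 1)) ≤ r := by
      have := Int.ceil_le.1 (show ⌈√((n : ℝ) / ((d : ℝ) - 1))⌉ ≤ (r : ℤ) by omega)
      exact_mod_cast this
    rw [Real.sqrt_le_left (Nat.cast_nonneg r), div_le_iff₀ (by linarith), ← hd1] at h1
    exact_mod_cast h1
  have hprob : ∀ r ∈ PQEC.probRanks X Y, (r : ℝ) < (n : ℝ) * d / ((d : ℝ) ^ 2 - 1) := by
    intro r hr
    by_contra! hle
    refine PQEC.notMem_probRanks hX hXY (r := r) ?_ hr
    rw [div_le_iff₀ (by nlinarith)] at hle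
    have : (n : ℝ) * d + r ≤ r * (d : ℝ) ^ 2 := by linarith
    exact_mod_cast this
  have hbperf : BddAbove (PQEC.perfRanks X Y) :=
    ⟨(⌈√((n : ℝ) / ((d : ℝ) - 1))⌉ - 1).toNat, fun r hr => by have := hperf r hr; omega⟩
  have hbprob : BddAbove (PQEC.probRanks X Y) :=
    ⟨⌈(n : ℝ) * d / ((d : ℝ) ^ 2 - 1)⌉₊, fun r hr => by
      exact_mod_cast (hprob r hr).le.trans (Nat.le_ceil _)⟩
  have h0perf : 0 ∈ PQEC.perfRanks X Y := PQEC.mem_perfRanks hX (by omega) (by simp)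
  have h0prob : 0 ∈ PQEC.probRanks X Y := PQEC.mem_probRanks hX (by simp; omega)
  have hmperf : PQEC.rPerf X Y ∈ PQEC.perfRanks X Y := Nat.sSup_mem ⟨0, h0perf⟩ hbperf
  have hmprob : PQEC.rProb X Y ∈ PQEC.probRanks X Y := Nat.sSup_mem ⟨0, h0prob⟩ hbprob
  refine ⟨⟨hmperf, fun r hr => le_csSup hbperf hr⟩, ⟨hmprob, fun r hr => le_csSup hbprob hr⟩,
    ?_, hperf _ hmperf, ?_, hprob _ hmprob⟩
  · set q : ℝ := ((n : ℝ) / d) ^ (1 / 4 : ℝ)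
    have hq0 : 0 ≤ q := Real.rpow_nonneg (by positivity) _
    have hq4 : q ^ 4 = (n : ℝ) / d := by
      rw [← Real.rpow_natCast, ← Real.rpow_mul (by positivity)]
      norm_num
    have hmem : ⌊q⌋₊ ∈ PQEC.perfRanks X Y := by
      refine PQEC.mem_perfRanks hX (by omega) ?_
      have h1 : (⌊q⌋₊ : ℝ) ^ 4 ≤ (n : ℝ) / d :=
        hq4 ▸ pow_le_pow_left₀ (Nat.cast_nonneg _) (Nat.floor_le hq0) 4
      rw [le_div_iff₀ (by linarith)] at h1
      exact_mod_cast h1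
    rw [← Int.natCast_floor_eq_floor hq0]
    exact_mod_cast le_csSup hbperf hmem
  · obtain ⟨r, hr⟩ := Int.eq_ofNat_of_zero_le
      (show 0 ≤ ⌈√((n : ℝ) / ((d : ℝ) - 1))⌉ - 1 by omega)
    rw [hr]
    have hmem : r ∈ PQEC.probRanks X Y := by
      refine PQEC.mem_probRanks hX ?_
      have h1 : (r : ℝ) < √((n : ℝ) / ((d : ℝ) - 1)) := by
        have := Int.lt_ceil.1 (show (r : ℤ) < ⌈√((n : ℝ) / ((d : ℝ) - 1))⌉ by omega)
        exact_mod_cast this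
      rw [Real.lt_sqrt (Nat.cast_nonneg r), lt_div_iff₀ (by linarith), ← hd1] at h1
      exact_mod_cast h1
    exact_mod_cast le_csSup hbprob hmem
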